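/- Let $n\ge 1$ and let $b\in C^\infty([0,\infty);\mathbb R)$ satisfy (H1) $b(t)\ge 0$ for all $t\ge 0$; (H2) $b$ is monotone on $[0,\infty)$ (non-decreasing or non-increasing); (H3) for every integer $k\ge 1$ there is a constant $C_k$ with $|b^{(k)}(t)|\le C_k\, b(t)\,(1+t)^{-k}$ for all $t\ge 0$; (E) $t\,b(t)\to\infty$ as $t\to\infty$; and assume $1/b\notin L^1([0,\infty))$. (These conditions force $b>0$ on $[0,\infty)$.) Consider the Cauchy problem $$u_{tt}-\Delta u+b(t)u_t=0\ \text{ in } [0,\infty)\times\mathbb R^n,\qquad u(0,\cdot)=u_1\in H^1(\mathbb R^n),\quad \mathrm D_tu(0,\cdot)=u_2\in L^2(\mathbb R^n),$$ with $\mathrm D_t=-i\partial_t$, for complex-valued solutions $u\in C([0,\infty);H^1)\cap C^1([0,\infty);L^2)$ (equation in the sense of tempered distributions in $x$). Let $|\mathrm D|=(-\Delta)^{1/2}$ and $\langle\mathrm D\rangle=(1-\Delta)^{1/2}$. Then for every $t\ge0$ the map $$\mathbb E(t):\ (\langle\mathrm D\rangle u_1,\,u_2)\mapsto(|\mathrm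 D|u(t,\cdot),\,\mathrm D_tu(t,\cdot))$$ is a well-defined bounded linear operator on $L^2(\mathbb R^n;\mathbb C^2)$ (for all data a solution exists, and its energy $(|\mathrm D|u,\mathrm D_tu)$ is uniquely determined). Denote its operator norm by $\|\mathbb E(t)\|_{2\to2}$. Moreover: 1. For every $U\in L^2(\mathbb R^n;\mathbb C^2)$, $$\lim_{t\to\infty}\sqrt{1+\int_0^t\frac{d\tau}{b(\tau)}}\;\mathbb E(t)U=0\quad\text{in }L^2(\mathbb R^n;\mathbb C^2).$$ 2. There is no function $\omega:[0,\infty)\to\mathbb R$ with $\omega(t)\to0$ as $t\to\infty$ such that $$\sqrt{1+\int_0^t\frac{d\tau}{b(\tau)}}\;\|\mathbb E(t)\|_{2\to2}\le\omega(t)\qquad\text{for all }t\ge0.$$ 3. There are constants $0<c\le C$ such that for all $t\ge0$ $$c\Big(1+\int_0^t\frac{d\tau}{b(\tau)}\Big)^{-1/2}\le\|\mathbb E(t)\|_{2\to2}\le C\Big(1+\int_0^t\frac{d\tau}{b(\tau)}\Big)^{-1/2}.$$ -/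

import Mathlib

open MeasureTheory Filter Topology Set
open scoped FourierTransform SchwartzMap Laplacian ContDiff

noncomputable section

/-- The space `L²(ℝⁿ)` of complex-valued functions. -/
abbrev L2 (n : ℕ) : Type := Lp ℂ 2 (volume : Measure (EuclideanSpace ℝ (Fin n)))

/-- The energy space `L²(ℝⁿ; ℂ²)`, i.e. pairs `(f, g)` with the norm
`(‖f‖² + ‖g‖²)^(1/2)`. -/
abbrev EnergySpace (n : ℕ) : Type := WithLp 2 (L2 n × L2 n)

/-- `g = m(D) f` for `f, g ∈ L²`, where the symbol `m` is a function of the Mathlib frequency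
variable `ξ` (Fourier transform with kernel `exp (-2πi x·ξ)`): `f` belongs to the domain of the
Fourier multiplier and its image is `g`. -/
def IsFourierMultiplier {n : ℕ} (m : EuclideanSpace ℝ (Fin n) → ℝ) (f g : L2 n) : Prop :=
  ∀ᵐ ξ ∂(volume : Measure (EuclideanSpace ℝ (Fin n))),
    (𝓕 g : L2 n) ξ = (m ξ : ℂ) * (𝓕 f : L2 n) ξ

/-- The symbol of `|D| = (-Δ)^(1/2)`. With the kernel `exp (-2πi x·ξ)` the operator
`D = -i∇` corresponds to `2πξ`. -/
def absSymbol (n : ℕ) (ξ : EuclideanSpace ℝ (Fin n)) : ℝ := 2 * Real.pi * ‖ξ‖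

/-- The symbol of `⟨D⟩ = (1 - Δ)^(1/2)`. -/
def japaneseSymbol (n : ℕ) (ξ : EuclideanSpace ℝ (Fin n)) : ℝ :=
  Real.sqrt (1 + (2 * Real.pi * ‖ξ‖) ^ 2)

/-- `u` is a solution on `[0, ∞)` of `u_tt - Δu + b(t) u_t = 0` in the energy class
`C([0,∞); H¹) ∩ C¹([0,∞); L²)`, with `absDu = |D| u` and `ut = ∂ₜ u`.
The equation holds in the sense of tempered distributions in `x`, for each `t ≥ 0`. -/
structure IsEnergySolution {n : ℕ} (b : ℝ → ℝ) (u absDu ut : ℝ → L2 n) : Prop where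
  absD_eq : ∀ t, 0 ≤ t → IsFourierMultiplier (absSymbol n) (u t) (absDu t)
  continuousOn_absDu : ContinuousOn absDu (Ici 0)
  hasDeriv : ∀ t, 0 ≤ t → HasDerivWithinAt u (ut t) (Ici 0) t
  continuousOn_ut : ContinuousOn ut (Ici 0)
  equation : ∀ φ : 𝓢(EuclideanSpace ℝ (Fin n), ℂ), ∀ t, 0 ≤ t →
    HasDerivWithinAt (fun s => (ut s : 𝓢'(EuclideanSpace ℝ (Fin n), ℂ)) φ)
      ((Δ (u t : 𝓢'(EuclideanSpace ℝ (Fin n), ℂ))) φ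
        - (b t : ℂ) * (ut t : 𝓢'(EuclideanSpace ℝ (Fin n), ℂ)) φ) (Ici 0) t

/-- `u` solves the Cauchy problem `u_tt - Δu + b(t) u_t = 0`, `u(0) = u₁`, `Dₜu(0) = u₂`
(with `Dₜ = -i∂ₜ`) where `⟨D⟩ u₁ = f` and `u₂ = g`; as above `absDu = |D| u` and `ut = ∂ₜ u`. -/
def SolvesCauchyProblem {n : ℕ} (b : ℝ → ℝ) (f g : L2 n) (u absDu ut : ℝ → L2 n) : Prop :=
  IsEnergySolution b u absDu ut ∧
    IsFourierMultiplier (japaneseSymbol n) (u 0) f ∧ (-Complex.I) • ut 0 = g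

/-- `T` is the map `(⟨D⟩ u₁, u₂) ↦ (|D| u(t), Dₜ u(t))` on `L²(ℝⁿ; ℂ²)`: for all data the Cauchy
problem has a solution, and `T` sends the data to the energy of every solution at time `t`.
There is at most one such `T`. -/
def IsEnergyOperatorAt {n : ℕ} (b : ℝ → ℝ) (t : ℝ)
    (T : EnergySpace n →L[ℂ] EnergySpace n) : Prop :=
  ∀ f g : L2 n,
    (∃ u absDu ut : ℝ → L2 n, SolvesCauchyProblem b f g u absDu ut) ∧
    ∀ u absDu ut : ℝ → L2 n, SolvesCauchyProblem b f g u absDu ut →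
      T (WithLp.toLp 2 (f, g)) = WithLp.toLp 2 (absDu t, (-Complex.I) • ut t)

theorem IsEnergyOperatorAt.unique {n : ℕ} {b : ℝ → ℝ} {t : ℝ}
    {T T' : EnergySpace n →L[ℂ] EnergySpace n}
    (h : IsEnergyOperatorAt b t T) (h' : IsEnergyOperatorAt b t T') : T = T' := by
  ext1 U
  obtain ⟨u, w, v, hs⟩ := (h U.fst U.snd).1
  exact ((h U.fst U.snd).2 u w v hs).trans ((h' U.fst U.snd).2 u w v hs).symm

open Classical in
/-- The energy operator `𝔼(t)`: the unique bounded operator on `L²(ℝⁿ; ℂ²)` with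
`𝔼(t) (⟨D⟩ u₁, u₂) = (|D| u(t), Dₜ u(t))` for the solution `u` of the Cauchy problem
(and `0` by convention should there be none). -/
def energyOperator (n : ℕ) (b : ℝ → ℝ) (t : ℝ) : EnergySpace n →L[ℂ] EnergySpace n :=
  if h : ∃ T : EnergySpace n →L[ℂ] EnergySpace n, IsEnergyOperatorAt b t T then h.choose else 0

/-- The factor `√(1 + ∫₀ᵗ dτ / b(τ))`. -/
def decayFactor (b : ℝ → ℝ) (t : ℝ) : ℝ :=
  Real.sqrt (1 + ∫ τ in (0 : ℝ)..t, 1 / b τ)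

end

/-! The Fourier transform in x turns the problem into the oscillators y'' + b y' + μ y = 0 with μ =
|2πξ|², and everything rests on estimates for E = μ y² + (y')² that are uniform in μ.

The main device is a multiplier adapted to b. Let w solve the adjoint equation w' = b w - 1 with w
comparable to 1/b (`exists_adjoint_weight`), and let W be a primitive of w, comparable to 1 + ∫ 1/b.
The functional F = W E / 2 + w y y' + y² / 2 has no mixed terms in its derivative, and when the
additive constant in W is large enough, F' ≤ -w E / 2 and F ≥ W E / 4 + y² / 4. This has three
consequences.

Upper bound: F(t) ≤ F(0) bounds W E by (1 + μ) y(0)² + y'(0)², which is exactly the norm of the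
data; integrating over ξ gives the operator bound.

Strong decay: F is nonincreasing and nonnegative, hence converges, and E is nonincreasing, so (W(t)
- W(s)) E(t) ≤ 2 (F(s) - F(t)). As W tends to infinity, which is where non-integrability of 1/b
enters, W E tends to 0 for each frequency, and dominated convergence carries this over to L².

Lower bound: y + w y' has derivative -μ w y, so for y(0) = 1, y'(0) = 0 it stays above 1/2 as long
as μ W(t) is small. At frequencies with μ of order 1 / W(t) this keeps W E bounded below
(`exists_weighted_energy_ge`). Data concentrated there, chosen anew for each t, give the lower
operator bound, which also excludes any rate.

Well-posedness is also proved on the frequency side. Solutions are entire power series in μ, hence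
measurable in ξ; uniqueness is an energy argument after multiplication by a decaying symbol. -/

/-! ### A linear system `y' = a p`, `p' = -μ e y` depending on a parameter -/

/-- The coefficients of the power series in `-μ` of the solution of `y' = a p`, `p' = -μ e y`. -/
noncomputable def picardCoeff (a e : ℝ → ℝ) (c₀ c₁ : ℝ) : ℕ → (ℝ → ℝ) × (ℝ → ℝ)
  | 0 => (fun t => c₀ + ∫ s in (0 : ℝ)..t, a s * c₁, fun _ => c₁)
  | k + 1 =>
    (fun t => ∫ s in (0 : ℝ)..t,
        a s * ∫ r in (0 : ℝ)..s, e r * (picardCoeff a e c₀ c₁ k).1 r,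
      fun t => ∫ r in (0 : ℝ)..t, e r * (picardCoeff a e c₀ c₁ k).1 r)

theorem continuous_picardCoeff {a e : ℝ → ℝ} (ha : Continuous a) (he : Continuous e)
    (c₀ c₁ : ℝ) (k : ℕ) :
    Continuous (picardCoeff a e c₀ c₁ k).1 ∧ Continuous (picardCoeff a e c₀ c₁ k).2 := by
  have hint : ∀ {f : ℝ → ℝ}, Continuous f → Continuous fun t => ∫ s in (0 : ℝ)..t, f s :=
    fun hf => intervalIntegral.continuous_primitive (fun _ _ => hf.intervalIntegrable _ _) 0
  induction k with
  | zero => exact ⟨continuous_const.add (hint (ha.mul continuous_const)), continuous_const⟩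
  | succ k ih =>
    have h := hint (he.mul ih.1)
    exact ⟨hint (ha.mul h), h⟩

theorem hasDerivAt_picardCoeff_fst {a e : ℝ → ℝ} (ha : Continuous a) (he : Continuous e)
    (c₀ c₁ : ℝ) (k : ℕ) (t : ℝ) :
    HasDerivAt (picardCoeff a e c₀ c₁ k).1 (a t * (picardCoeff a e c₀ c₁ k).2 t) t := by
  have hc := ha.mul (continuous_picardCoeff ha he c₀ c₁ k).2
  have h := hc.integral_hasStrictDerivAt 0 t
  cases k with
  | zero => exact h.hasDerivAt.const_add c₀
  | succ k => exact h.hasDerivAt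

theorem hasDerivAt_picardCoeff_snd_succ {a e : ℝ → ℝ} (ha : Continuous a) (he : Continuous e)
    (c₀ c₁ : ℝ) (k : ℕ) (t : ℝ) :
    HasDerivAt (picardCoeff a e c₀ c₁ (k + 1)).2 (e t * (picardCoeff a e c₀ c₁ k).1 t) t :=
  ((he.mul (continuous_picardCoeff ha he c₀ c₁ k).1).integral_hasStrictDerivAt 0 t).hasDerivAt

/-- One integration raises both the power and the factorial by one. The unordered interval allows
negative t as well. -/
theorem abs_integral_le_of_abs_le_pow {f : ℝ → ℝ} {D : ℝ} {k : ℕ} {t : ℝ}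
    (h : ∀ s ∈ uIoc 0 t, |f s| ≤ D * (|s| ^ k / k.factorial)) :
    |∫ s in (0 : ℝ)..t, f s| ≤ D * (|t| ^ (k + 1) / (k + 1).factorial) := by
  have h1 : |∫ s in (0 : ℝ)..t, f s| ≤ ∫ s in uIoc 0 t, D / k.factorial * |s - 0| ^ k := by
    rw [← Real.norm_eq_abs, intervalIntegral.norm_integral_eq_norm_integral_uIoc]
    refine norm_integral_le_of_norm_le ?_ ?_
    · have hc : Continuous fun s : ℝ => D / k.factorial * |s - 0| ^ k := by fun_prop
      exact intervalIntegrable_iff.1 (hc.intervalIntegrable _ _)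
    · refine (ae_restrict_mem measurableSet_uIoc).mono fun s hs => ?_
      rw [Real.norm_eq_abs, sub_zero]
      exact (h s hs).trans (le_of_eq (by ring))
  refine h1.trans (le_of_eq ?_)
  rw [integral_const_mul, integral_pow_abs_sub_uIoc, sub_zero, Nat.factorial_succ]
  push_cast
  field_simp

/-- Each recursion step integrates twice, but only the inner integral is used to gain a factor |t| /
(k + 1); the outer one costs at most K R, absorbed in Q. The last two bounds majorize the termwise
derivatives. -/
theorem exists_picardCoeff_bound {a e : ℝ → ℝ} (ha : Continuous a) (he : Continuous e)
    (c₀ c₁ : ℝ) (R : ℝ) (hR : 0 ≤ R) :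
    ∃ M Q : ℝ, 0 ≤ M ∧ 0 ≤ Q ∧ ∀ k t, |t| ≤ R →
      |(picardCoeff a e c₀ c₁ k).1 t| ≤ M * Q ^ k * (|t| ^ k / k.factorial) ∧
      |(picardCoeff a e c₀ c₁ k).2 t| ≤ M * Q ^ k * (|t| ^ k / k.factorial) ∧
      |a t * (picardCoeff a e c₀ c₁ k).2 t| ≤ Q * (M * Q ^ k * (|t| ^ k / k.factorial)) ∧
      |e t * (picardCoeff a e c₀ c₁ k).1 t| ≤ Q * (M * Q ^ k * (|t| ^ k / k.factorial)) := by
  have hcpt : IsCompact (Icc (-R) R) := isCompact_Icc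
  obtain ⟨Ka, hKa⟩ := hcpt.exists_bound_of_continuousOn ha.continuousOn
  obtain ⟨Ke, hKe⟩ := hcpt.exists_bound_of_continuousOn he.continuousOn
  obtain ⟨M₀, hM₀⟩ := hcpt.exists_bound_of_continuousOn
    (continuous_picardCoeff ha he c₀ c₁ 0).1.continuousOn
  set K := max 1 (max Ka Ke)
  have hK1 : 1 ≤ K := le_max_left _ _
  have hKa' : ∀ t, |t| ≤ R → |a t| ≤ K := fun t ht =>
    (hKa t (abs_le.1 ht)).trans ((le_max_left _ _).trans (le_max_right _ _))
  have hKe' : ∀ t, |t| ≤ R → |e t| ≤ K := fun t ht =>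
    (hKe t (abs_le.1 ht)).trans ((le_max_right _ _).trans (le_max_right _ _))
  set M := max |c₁| (max 0 M₀)
  set Q := K * K * (1 + R)
  have hM : 0 ≤ M := (abs_nonneg _).trans (le_max_left _ _)
  have hKQ : K ≤ Q := by nlinarith [mul_nonneg (mul_nonneg (zero_le_one.trans hK1)
    (zero_le_one.trans hK1)) hR]
  have hQ : 0 ≤ Q := (zero_le_one.trans hK1).trans hKQ
  have habs : ∀ {s t : ℝ}, s ∈ uIoc 0 t → |s| ≤ |t| := by
    intro s t hs
    rcases mem_uIoc.1 hs with h | h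
    · rw [abs_of_pos h.1, abs_of_pos (h.1.trans_le h.2)]; exact h.2
    · rw [abs_of_nonpos h.2, abs_of_neg (h.1.trans_le h.2)]; linarith [h.1]
  have key : ∀ k t, |t| ≤ R →
      |(picardCoeff a e c₀ c₁ k).1 t| ≤ M * Q ^ k * (|t| ^ k / k.factorial) ∧
      |(picardCoeff a e c₀ c₁ k).2 t| ≤ M * Q ^ k * (|t| ^ k / k.factorial) := by
    intro k
    induction k with
    | zero =>
      intro t ht
      simp only [pow_zero, Nat.factorial_zero, Nat.cast_one, div_one, mul_one]
      exact ⟨(hM₀ t (abs_le.1 ht)).trans ((le_max_right _ _).trans (le_max_right _ _)),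
        le_max_left _ _⟩
    | succ k ih =>
      have h2 : ∀ t, |t| ≤ R → |(picardCoeff a e c₀ c₁ (k + 1)).2 t| ≤
          K * (M * Q ^ k) * (|t| ^ (k + 1) / (k + 1).factorial) := by
        intro t ht
        refine abs_integral_le_of_abs_le_pow fun s hs => ?_
        have hs' := (habs hs).trans ht
        rw [abs_mul, mul_assoc]
        exact mul_le_mul (hKe' s hs') (ih s hs').1 (abs_nonneg _) (by linarith)
      intro t ht
      have hpos : 0 ≤ |t| ^ (k + 1) / ((k + 1).factorial : ℝ) := by positivity
      refine ⟨?_, (h2 t ht).trans ?_⟩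
      · have h1 : |(picardCoeff a e c₀ c₁ (k + 1)).1 t| ≤
            K * (K * (M * Q ^ k) * (|t| ^ (k + 1) / (k + 1).factorial)) * |t| := by
          have := intervalIntegral.norm_integral_le_of_norm_le_const (a := 0) (b := t)
            (f := fun s => a s * (picardCoeff a e c₀ c₁ (k + 1)).2 s)
            (C := K * (K * (M * Q ^ k) * (|t| ^ (k + 1) / (k + 1).factorial))) ?_
          · rwa [sub_zero] at this
          · intro s hs
            have hs' := (habs hs).trans ht
            rw [Real.norm_eq_abs, abs_mul]
            refine mul_le_mul (hKa' s hs') ((h2 s hs').trans ?_) (abs_nonneg _) (by linarith)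
            have := habs hs
            gcongr
        refine h1.trans ?_
        have : K * (K * (M * Q ^ k) * (|t| ^ (k + 1) / (k + 1).factorial)) * |t| =
          (M * Q ^ k * (|t| ^ (k + 1) / (k + 1).factorial)) * (K * K * |t|) := by ring
        rw [this, pow_succ Q, ← mul_assoc M, mul_right_comm _ Q]
        refine mul_le_mul_of_nonneg_left ?_ (by positivity)
        simp only [Q]
        gcongr
        linarith
      · rw [pow_succ Q, mul_comm K, ← mul_assoc M]
        gcongr
  refine ⟨M, Q, hM, hQ, fun k t ht => ⟨(key k t ht).1, (key k t ht).2, ?_, ?_⟩⟩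
  · rw [abs_mul]
    exact mul_le_mul ((hKa' t ht).trans hKQ) (key k t ht).2 (abs_nonneg _) hQ
  · rw [abs_mul]
    exact mul_le_mul ((hKe' t ht).trans hKQ) (key k t ht).1 (abs_nonneg _) hQ

/-- Global solvability of `y' = a p`, `p' = -μ e y`, with measurable dependence on `μ`. -/
theorem exists_linearSystem_solution {a e : ℝ → ℝ} (ha : Continuous a) (he : Continuous e)
    (c₀ c₁ : ℝ) :
    ∃ y p : ℝ → ℝ → ℝ, (∀ t, Measurable (y t)) ∧ (∀ t, Measurable (p t)) ∧
      (∀ μ, y 0 μ = c₀) ∧ (∀ μ, p 0 μ = c₁) ∧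
      (∀ μ t, HasDerivAt (fun s => y s μ) (a t * p t μ) t) ∧
      (∀ μ t, HasDerivAt (fun s => p s μ) (-(μ * (e t * y t μ))) t) := by
  set Y := fun k => (picardCoeff a e c₀ c₁ k).1 with hY
  set P := fun k => (picardCoeff a e c₀ c₁ k).2 with hP
  have hbd : ∀ μ R : ℝ, 0 ≤ R → ∃ u : ℕ → ℝ, Summable u ∧ ∀ k t, |t| ≤ R →
      |(-μ) ^ k * Y k t| ≤ u k ∧ |(-μ) ^ k * P k t| ≤ u k ∧
      |(-μ) ^ k * (a t * P k t)| ≤ u k ∧ |(-μ) ^ k * (e t * Y k t)| ≤ u k := by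
    intro μ R hR
    obtain ⟨M, Q, hM, hQ, h⟩ := exists_picardCoeff_bound ha he c₀ c₁ R hR
    refine ⟨fun k => ((1 + Q) * M) * ((|μ| * Q * R) ^ k / k.factorial),
      (Real.summable_pow_div_factorial _).mul_left _, fun k t ht => ?_⟩
    have hmain : |μ| ^ k * (M * Q ^ k * (|t| ^ k / k.factorial)) ≤
        M * ((|μ| * Q * R) ^ k / k.factorial) := by
      have : M * ((|μ| * Q * R) ^ k / k.factorial) =
        |μ| ^ k * (M * Q ^ k * (R ^ k / k.factorial)) := by rw [mul_pow, mul_pow]; ring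
      rw [this]; gcongr
    have hnn : 0 ≤ M * ((|μ| * Q * R) ^ k / k.factorial) := by positivity
    have e1 : ∀ x, |x| ≤ M * Q ^ k * (|t| ^ k / k.factorial) →
        |(-μ) ^ k * x| ≤ (1 + Q) * M * ((|μ| * Q * R) ^ k / k.factorial) := by
      intro x hx
      rw [abs_mul, abs_pow, abs_neg]
      refine ((mul_le_mul_of_nonneg_left hx (by positivity)).trans hmain).trans ?_
      nlinarith [mul_nonneg hQ hnn]
    have e2 : ∀ x, |x| ≤ Q * (M * Q ^ k * (|t| ^ k / k.factorial)) →
        |(-μ) ^ k * x| ≤ (1 + Q) * M * ((|μ| * Q * R) ^ k / k.factorial) := by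
      intro x hx
      rw [abs_mul, abs_pow, abs_neg]
      refine (mul_le_mul_of_nonneg_left hx (by positivity)).trans ?_
      have := mul_le_mul_of_nonneg_left hmain hQ
      nlinarith
    obtain ⟨h1, h2, h3, h4⟩ := h k t ht
    exact ⟨e1 _ h1, e1 _ h2, e2 _ h3, e2 _ h4⟩
  have hsY : ∀ μ t, Summable fun k => (-μ) ^ k * Y k t := fun μ t => by
    obtain ⟨u, hu, h⟩ := hbd μ |t| (abs_nonneg t)
    exact Summable.of_norm_bounded hu fun k => (h k t le_rfl).1
  have hsP : ∀ μ t, Summable fun k => (-μ) ^ k * P k t := fun μ t => by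
    obtain ⟨u, hu, h⟩ := hbd μ |t| (abs_nonneg t)
    exact Summable.of_norm_bounded hu fun k => (h k t le_rfl).2.1
  -- Measurability in μ: the partial sums are polynomials in μ.
  have hmeas : ∀ c : ℕ → ℝ, (∀ μ : ℝ, Summable fun k => (-μ) ^ k * c k) →
      Measurable fun μ : ℝ => ∑' k, (-μ) ^ k * c k := fun c hc => by
    refine measurable_of_tendsto_metrizable
      (f := fun N (μ : ℝ) => ∑ k ∈ Finset.range N, (-μ) ^ k * c k) (fun N => ?_) ?_
    · fun_prop
    · exact tendsto_pi_nhds.2 fun μ => (hc μ).hasSum.tendsto_sum_nat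
  have hY0 : ∀ k, Y (k + 1) 0 = 0 := fun k => intervalIntegral.integral_same
  have hP0 : ∀ k, P (k + 1) 0 = 0 := fun k => intervalIntegral.integral_same
  refine ⟨fun t μ => ∑' k, (-μ) ^ k * Y k t, fun t μ => ∑' k, (-μ) ^ k * P k t,
    fun t => hmeas _ fun μ => hsY μ t, fun t => hmeas _ fun μ => hsP μ t, fun μ => ?_,
    fun μ => ?_, fun μ t => ?_, fun μ t => ?_⟩
  · have h := (hsY μ 0).tsum_eq_zero_add
    simp only [hY0, mul_zero, tsum_zero, pow_zero, one_mul, add_zero] at h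
    refine h.trans ?_
    simp [hY, picardCoeff]
  · have h := (hsP μ 0).tsum_eq_zero_add
    simp only [hP0, mul_zero, tsum_zero, pow_zero, one_mul, add_zero] at h
    refine h.trans ?_
    simp [hP, picardCoeff]
  · obtain ⟨u, hu, h⟩ := hbd μ (|t| + 1) (by positivity)
    have hmem : ∀ s ∈ Ioo (-(|t| + 1)) (|t| + 1), |s| ≤ |t| + 1 := fun s hs => (abs_lt.2 hs).le
    have htm : t ∈ Ioo (-(|t| + 1)) (|t| + 1) := abs_lt.1 (lt_add_one _)
    have hd := hasDerivAt_tsum_of_isPreconnected hu isOpen_Ioo isPreconnected_Ioo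
      (g := fun k s => (-μ) ^ k * Y k s) (g' := fun k s => (-μ) ^ k * (a s * P k s))
      (fun k s _ => (hasDerivAt_picardCoeff_fst ha he c₀ c₁ k s).const_mul _)
      (fun k s hs => (h k s (hmem s hs)).2.2.1) htm (hsY μ t) htm
    refine hd.congr_deriv ?_
    rw [← tsum_mul_left]
    exact tsum_congr fun k => by ring
  · obtain ⟨u, hu, h⟩ := hbd μ (|t| + 1) (by positivity)
    have hmem : ∀ s ∈ Ioo (-(|t| + 1)) (|t| + 1), |s| ≤ |t| + 1 := fun s hs => (abs_lt.2 hs).le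
    have htm : t ∈ Ioo (-(|t| + 1)) (|t| + 1) := abs_lt.1 (lt_add_one _)
    -- The constant term c₁ is split off: the derivative of the term of index k + 1 is -μ e times
    -- the term of index k of the other series, which explains the extra |μ| in the majorant.
    have hd := hasDerivAt_tsum_of_isPreconnected (hu.mul_left |μ|) isOpen_Ioo isPreconnected_Ioo
      (g := fun k s => (-μ) ^ (k + 1) * P (k + 1) s)
      (g' := fun k s => (-μ) ^ (k + 1) * (e s * Y k s))
      (fun k s _ => (hasDerivAt_picardCoeff_snd_succ ha he c₀ c₁ k s).const_mul _)
      (fun k s hs => by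
        rw [pow_succ', mul_assoc, Real.norm_eq_abs, abs_mul, abs_neg]
        exact mul_le_mul_of_nonneg_left (h k s (hmem s hs)).2.2.2 (abs_nonneg _))
      htm ((summable_nat_add_iff 1).2 (hsP μ t)) htm
    have heq : (fun s => ∑' k, (-μ) ^ k * P k s) =
        fun s => c₁ + ∑' k, (-μ) ^ (k + 1) * P (k + 1) s := by
      funext s
      rw [(hsP μ s).tsum_eq_zero_add]
      simp [hP, picardCoeff]
    rw [heq]
    refine (hd.const_add c₁).congr_deriv ?_
    rw [← tsum_mul_left, ← tsum_mul_left, ← tsum_neg]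
    exact tsum_congr fun k => by rw [pow_succ']; ring

/-- The fundamental solutions of `y'' + b y' + μ y = 0` as functions of the parameter `μ`. -/
theorem exists_dampedOscillator_solution {b : ℝ → ℝ} (hb : Continuous b) (c₀ c₁ : ℝ) :
    ∃ y z : ℝ → ℝ → ℝ, (∀ t, Measurable (y t)) ∧ (∀ t, Measurable (z t)) ∧
      (∀ μ, y 0 μ = c₀) ∧ (∀ μ, z 0 μ = c₁) ∧
      (∀ μ t, HasDerivAt (fun s => y s μ) (z t μ) t) ∧
      (∀ μ t, HasDerivAt (fun s => z s μ) (-(b t * z t μ) - μ * y t μ) t) := by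
  set β : ℝ → ℝ := fun t => ∫ s in (0 : ℝ)..t, b s with hβ
  have hβd : ∀ t, HasDerivAt β (b t) t := fun t => (hb.integral_hasStrictDerivAt 0 t).hasDerivAt
  have hβc : Continuous β := continuous_iff_continuousAt.2 fun t => (hβd t).continuousAt
  -- The integrating factor removes the damping: p = exp(β) y' satisfies p' = -μ exp(β) y.
  obtain ⟨y, p, hy, hp, hy0, hp0, hyd, hpd⟩ := exists_linearSystem_solution
    (a := fun t => Real.exp (-β t)) (e := fun t => Real.exp (β t))
    (by fun_prop) (by fun_prop) c₀ c₁
  refine ⟨y, fun t μ => Real.exp (-β t) * p t μ, hy, fun t => (hp t).const_mul _, hy0,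
    fun μ => by simp [hβ, hp0], hyd, fun μ t => ?_⟩
  refine ((hβd t).neg.exp.mul (hpd μ t)).congr_deriv ?_
  have : Real.exp (-β t) * Real.exp (β t) = 1 := by rw [← Real.exp_add]; simp
  linear_combination (-(μ * y t μ)) * this.symm * (-1)

/-! ### Weights adapted to an effective damping -/

/-- A positive damping coefficient with `|b'| ≤ C b / (1 + t)` and `t b → ∞`. -/
structure IsEffectiveDamping (b b' : ℝ → ℝ) (C : ℝ) : Prop where
  continuous : Continuous b
  pos : ∀ t, 0 < b t
  hasDerivAt : ∀ t, 0 < t → HasDerivAt b (b' t) t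
  abs_deriv_le : ∀ t, 0 < t → |b' t| ≤ C * b t / (1 + t)
  tendsto : Tendsto (fun t => t * b t) atTop atTop

/-- The primitive `∫₀ᵗ dτ / b(τ)`. -/
noncomputable def invIntegral (b : ℝ → ℝ) (t : ℝ) : ℝ := ∫ τ in (0 : ℝ)..t, 1 / b τ

namespace IsEffectiveDamping

theorem hasDerivAt_invIntegral {b b' : ℝ → ℝ} {C : ℝ} (hb : IsEffectiveDamping b b' C) (t : ℝ) :
    HasDerivAt (invIntegral b) (1 / b t) t := by
  have hc : Continuous fun t => 1 / b t :=
    continuous_const.div hb.continuous fun t => (hb.pos t).ne'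
  exact (hc.integral_hasStrictDerivAt 0 t).hasDerivAt

/-- The derivative of (1 + t) / b is at most (1 + C) / b because |b'| ≤ C b / (1 + t). In K, the
entry 1 / b(0) settles t = 0 and 1 + C settles the growth. -/
theorem one_add_div_le {b b' : ℝ → ℝ} {C : ℝ} (hb : IsEffectiveDamping b b' C) :
    ∃ K, 0 < K ∧ ∀ t, 0 ≤ t → (1 + t) / b t ≤ K * (1 + invIntegral b t) := by
  set K := max (1 / b 0) (1 + C)
  have hK : 0 < K := lt_max_of_lt_left (one_div_pos.2 (hb.pos 0))
  refine ⟨K, hK, fun t ht => ?_⟩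
  have hd : ∀ s, 0 < s → HasDerivAt (fun s => K * (1 + invIntegral b s) - (1 + s) / b s)
      (K * (1 / b s) - (1 * b s - (1 + s) * b' s) / b s ^ 2) s := fun s hs =>
    (((hb.hasDerivAt_invIntegral s).const_add 1).const_mul K).sub
      (((hasDerivAt_id s).const_add 1).div (hb.hasDerivAt s hs) (hb.pos s).ne')
  have hmono : MonotoneOn (fun s => K * (1 + invIntegral b s) - (1 + s) / b s) (Ici 0) := by
    refine monotoneOn_of_deriv_nonneg (convex_Ici 0) ?_ ?_ ?_
    · have h1 : Continuous (invIntegral b) :=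
        continuous_iff_continuousAt.2 fun t => (hb.hasDerivAt_invIntegral t).continuousAt
      have h2 : Continuous fun s => (1 + s) / b s :=
        (by fun_prop : Continuous fun s : ℝ => 1 + s).div hb.continuous fun t => (hb.pos t).ne'
      exact (by fun_prop : Continuous _).continuousOn
    · rw [interior_Ici]
      exact fun s hs => (hd s hs).differentiableAt.differentiableWithinAt
    · rw [interior_Ici]
      intro s hs
      rw [(hd s hs).deriv]
      have hbs := hb.pos s
      have h1s : (0 : ℝ) < 1 + s := by linarith [mem_Ioi.1 hs]
      have h := hb.abs_deriv_le s hs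
      rw [le_div_iff₀ h1s] at h
      have h' : -(b' s) * (1 + s) ≤ C * b s :=
        (mul_le_mul_of_nonneg_right (neg_le_abs _) h1s.le).trans h
      have hKC : 1 + C ≤ K := le_max_right _ _
      have : K * (1 / b s) - (1 * b s - (1 + s) * b' s) / b s ^ 2 =
          (K * b s - b s + (1 + s) * b' s) / b s ^ 2 := by field_simp; ring
      rw [this]
      refine div_nonneg ?_ (by positivity)
      nlinarith
  have h0 := hmono (mem_Ici.2 le_rfl) (mem_Ici.2 ht) ht
  have hz : invIntegral b 0 = 0 := intervalIntegral.integral_same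
  simp only [hz, add_zero, mul_one] at h0
  have : 1 / b 0 ≤ K := le_max_left _ _
  linarith

theorem invIntegral_nonneg {b b' : ℝ → ℝ} {C : ℝ} (hb : IsEffectiveDamping b b' C) {t : ℝ}
    (ht : 0 ≤ t) : 0 ≤ invIntegral b t :=
  intervalIntegral.integral_nonneg ht fun s _ => (one_div_pos.2 (hb.pos s)).le

/-- For large t, `one_add_div_le` gives b² (1 + ∫ 1/b) ≥ b (1 + t) / K₁, which exceeds K since t b
tends to infinity. On the remaining compact interval b has a positive minimum and a large A
suffices. -/
theorem exists_le_sq_mul {b b' : ℝ → ℝ} {C : ℝ} (hb : IsEffectiveDamping b b' C) {K : ℝ}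
    (hK : 0 ≤ K) : ∃ A, 1 ≤ A ∧ ∀ t, 0 ≤ t → K ≤ b t ^ 2 * (A + invIntegral b t) := by
  obtain ⟨K₁, hK₁, h₁⟩ := hb.one_add_div_le
  obtain ⟨T, hT⟩ := (hb.tendsto.eventually_ge_atTop (K * K₁)).exists_forall_of_atTop
  obtain ⟨s, -, hs⟩ := isCompact_Icc.exists_isMinOn (nonempty_Icc.2 (le_max_left 0 T))
    hb.continuous.continuousOn
  refine ⟨max 1 (K / b s ^ 2), le_max_left _ _, fun t ht => ?_⟩
  have hbt := hb.pos t
  have hB := hb.invIntegral_nonneg ht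
  rcases le_total t (max 0 T) with h | h
  · have hle : b s ≤ b t := hs (mem_Icc.2 ⟨ht, h⟩)
    have hbs := hb.pos s
    calc K = b s ^ 2 * (K / b s ^ 2) := by field_simp
      _ ≤ b t ^ 2 * (max 1 (K / b s ^ 2) + invIntegral b t) := by
        gcongr
        exact (le_max_right _ _).trans (le_add_of_nonneg_right hB)
  · have h2 := h₁ t ht
    have h3 := hT t ((le_max_right _ _).trans h)
    rw [div_le_iff₀ hbt] at h2
    have h4 : K * K₁ ≤ (b t ^ 2 * (1 + invIntegral b t)) * K₁ := by nlinarith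
    refine (le_of_mul_le_mul_right h4 hK₁).trans ?_
    gcongr
    exact le_max_left _ _

/-- The equation `w' = b w - 1` has a solution comparable to `1 / b`. -/
theorem exists_adjoint_weight {b b' : ℝ → ℝ} {C : ℝ} (hb : IsEffectiveDamping b b' C) :
    ∃ (w : ℝ → ℝ) (c D : ℝ), 0 < c ∧ 0 < D ∧ (∀ t, HasDerivAt w (b t * w t - 1) t) ∧
      ∀ t, 0 ≤ t → c / b t ≤ w t ∧ w t ≤ D / b t := by
  set β : ℝ → ℝ := fun t => ∫ s in (0 : ℝ)..t, b s with hβ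
  have hβd : ∀ t, HasDerivAt β (b t) t :=
    fun t => (hb.continuous.integral_hasStrictDerivAt 0 t).hasDerivAt
  have hβc : Continuous β := continuous_iff_continuousAt.2 fun t => (hβd t).continuousAt
  set h : ℝ → ℝ := fun t => Real.exp (-β t) with hh
  have hhpos : ∀ t, 0 < h t := fun t => Real.exp_pos _
  have hhc : Continuous h := by fun_prop
  have hhd : ∀ t, HasDerivAt h (-(b t * h t)) t := fun t =>
    (hβd t).neg.exp.congr_deriv (by simp only [hh, Pi.neg_apply]; ring)
  set H : ℝ → ℝ := fun t => ∫ s in (0 : ℝ)..t, h s with hH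
  have hHd : ∀ t, HasDerivAt H (h t) t :=
    fun t => (hhc.integral_hasStrictDerivAt 0 t).hasDerivAt
  have hHc : Continuous H := continuous_iff_continuousAt.2 fun t => (hHd t).continuousAt
  have hHm : StrictMono H := strictMono_of_deriv_pos fun t => by rw [(hHd t).deriv]; exact hhpos t
  -- Beyond T, t b ≥ 2 makes h t² decrease, and t b ≥ 2 C makes |b'| / b² ≤ 1/2.
  obtain ⟨T₀, hT₀⟩ :=
    (hb.tendsto.eventually_ge_atTop (max 2 (2 * C))).exists_forall_of_atTop
  set T := max 1 T₀
  have hT1 : 1 ≤ T := le_max_left _ _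
  have hTb : ∀ t, T ≤ t → 2 ≤ t * b t ∧ 2 * C ≤ t * b t := fun t ht =>
    max_le_iff.1 (hT₀ t ((le_max_right _ _).trans ht))
  -- decay of `q = h / b`
  set q : ℝ → ℝ := fun t => h t / b t with hq
  have hqpos : ∀ t, 0 < q t := fun t => div_pos (hhpos t) (hb.pos t)
  have hqc : Continuous q := hhc.div hb.continuous fun t => (hb.pos t).ne'
  -- Here (h t²)' = h t (2 - t b) ≤ 0. Together with 1 / b ≤ t / 2 this yields q = O(1/t).
  have hanti : AntitoneOn (fun t => h t * t ^ 2) (Ici T) := by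
    have hd : ∀ t, HasDerivAt (fun t => h t * t ^ 2)
        (-(b t * h t) * t ^ 2 + h t * (2 * t)) t := fun t => by
      exact ((hhd t).mul (hasDerivAt_pow 2 t)).congr_deriv (by norm_num)
    refine antitoneOn_of_deriv_nonpos (convex_Ici T) (by fun_prop)
      (fun t _ => (hd t).differentiableAt.differentiableWithinAt) fun t ht => ?_
    rw [interior_Ici] at ht
    rw [(hd t).deriv]
    have h1 := (hTb t (mem_Ioi.1 ht).le).1
    have h2 : 0 ≤ h t * t := mul_nonneg (hhpos t).le (by linarith [mem_Ioi.1 ht])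
    nlinarith
  have hq0 : Tendsto q atTop (𝓝 0) := by
    have hlim : Tendsto (fun t : ℝ => h T * T ^ 2 / 2 * t⁻¹) atTop (𝓝 0) := by
      have := (tendsto_inv_atTop_zero (𝕜 := ℝ)).const_mul (h T * T ^ 2 / 2)
      rwa [mul_zero] at this
    refine squeeze_zero' (Eventually.of_forall fun t => (hqpos t).le) ?_ hlim
    filter_upwards [eventually_ge_atTop T] with t ht
    have h1 := (hTb t ht).1
    have h2 : h t * t ^ 2 ≤ h T * T ^ 2 := hanti (mem_Ici.2 le_rfl) (mem_Ici.2 ht) ht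
    have ht0 : 0 < t := by linarith
    have hbt := hb.pos t
    rw [hq, ← div_eq_mul_inv, div_le_div_iff₀ hbt ht0]
    have h3 : h t * t * 2 ≤ h t * t * (t * b t) :=
      mul_le_mul_of_nonneg_left h1 (mul_nonneg (hhpos t).le ht0.le)
    have h4 := mul_le_mul_of_nonneg_right h2 hbt.le
    linarith
  -- derivative of `q`
  have hqd : ∀ t, 0 < t → HasDerivAt q (-h t - h t * (b' t / b t ^ 2)) t := fun t ht =>
    ((hhd t).div (hb.hasDerivAt t ht) (hb.pos t).ne').congr_deriv (by
      have := hb.pos t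
      field_simp)
  have hsmall : ∀ t, T ≤ t → |b' t / b t ^ 2| ≤ 1 / 2 := fun t ht => by
    have ht0 : 0 < t := by linarith
    have hbt := hb.pos t
    have h1 := hb.abs_deriv_le t ht0
    have h2 := (hTb t ht).2
    rw [abs_div, abs_of_pos (by positivity : 0 < b t ^ 2), div_le_iff₀ (by positivity)]
    refine h1.trans ?_
    rw [div_le_iff₀ (by linarith)]
    nlinarith [mul_le_mul_of_nonneg_right h2 hbt.le, sq_nonneg (b t)]
  have hcomb : ∀ k : ℝ, ∀ t, 0 < t → HasDerivAt (fun t => q t + k * H t)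
      (-h t - h t * (b' t / b t ^ 2) + k * h t) t := fun k t ht =>
    (hqd t ht).add ((hHd t).const_mul k)
  -- Since q' lies between -(3/2) h and -(1/2) h, comparing with the values at infinity sandwiches
  -- the tail of the integral of h between (2/3) q and 2 q.
  have hA : AntitoneOn (fun t => q t + 1 / 2 * H t) (Ici T) := by
    refine antitoneOn_of_deriv_nonpos (convex_Ici T) (by fun_prop) ?_ ?_
    · rw [interior_Ici]
      exact fun t ht => (hcomb _ t (by
        linarith [mem_Ioi.1 ht])).differentiableAt.differentiableWithinAt
    · rw [interior_Ici]
      intro t ht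
      rw [(hcomb _ t (by linarith [mem_Ioi.1 ht])).deriv]
      have := (abs_le.1 (hsmall t (mem_Ioi.1 ht).le)).1
      nlinarith [hhpos t]
  have hM : MonotoneOn (fun t => q t + 3 / 2 * H t) (Ici T) := by
    refine monotoneOn_of_deriv_nonneg (convex_Ici T) (by fun_prop) ?_ ?_
    · rw [interior_Ici]
      exact fun t ht => (hcomb _ t (by
        linarith [mem_Ioi.1 ht])).differentiableAt.differentiableWithinAt
    · rw [interior_Ici]
      intro t ht
      rw [(hcomb _ t (by linarith [mem_Ioi.1 ht])).deriv]
      have := (abs_le.1 (hsmall t (mem_Ioi.1 ht).le)).2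
      nlinarith [hhpos t]
  have hbdd : BddAbove (range H) := by
    refine ⟨2 * (q T + 1 / 2 * H T), ?_⟩
    rintro _ ⟨t, rfl⟩
    have h1 : q (max t T) + 1 / 2 * H (max t T) ≤ q T + 1 / 2 * H T :=
      hA (mem_Ici.2 le_rfl) (mem_Ici.2 (le_max_right _ _)) (le_max_right _ _)
    have h2 : H t ≤ H (max t T) := hHm.monotone (le_max_left _ _)
    linarith [hqpos (max t T)]
  set K := ⨆ t, H t
  have hHK : Tendsto H atTop (𝓝 K) := tendsto_atTop_ciSup hHm.monotone hbdd
  have hlt : ∀ t, H t < K := fun t =>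
    (hHm (lt_add_one t)).trans_le (le_ciSup hbdd (t + 1))
  have hlim : ∀ k : ℝ, Tendsto (fun t => q t + k * H t) atTop (𝓝 (0 + k * K)) := fun k =>
    hq0.add (hHK.const_mul k)
  -- This is the integral of exp(β(t) - β(s)) over s ≥ t; every other solution differs from it by a
  -- multiple of exp(β).
  set w : ℝ → ℝ := fun t => (K - H t) * Real.exp (β t) with hw
  have hwd : ∀ t, HasDerivAt w (b t * w t - 1) t := fun t => by
    refine (((hHd t).const_sub K).mul (hβd t).exp).congr_deriv ?_
    have : h t * Real.exp (β t) = 1 := by simp only [hh]; rw [← Real.exp_add]; simp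
    simp only [hw]
    linear_combination (-1) * this
  have hwh : ∀ t, w t = (K - H t) / h t := fun t => by
    simp only [hw, hh, Real.exp_neg, div_inv_eq_mul]
  have hwpos : ∀ t, 0 < w t := fun t => mul_pos (sub_pos.2 (hlt t)) (Real.exp_pos _)
  have hwc : Continuous w := continuous_iff_continuousAt.2 fun t => (hwd t).continuousAt
  have hlarge : ∀ t, T ≤ t → 2 / 3 ≤ b t * w t ∧ b t * w t ≤ 2 := fun t ht => by
    have h1 : 0 + 1 / 2 * K ≤ q t + 1 / 2 * H t := by
      refine le_of_tendsto (hlim _) ?_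
      filter_upwards [eventually_ge_atTop t] with s hs
      exact hA (mem_Ici.2 ht) (mem_Ici.2 (ht.trans hs)) hs
    have h2 : q t + 3 / 2 * H t ≤ 0 + 3 / 2 * K := by
      refine ge_of_tendsto (hlim _) ?_
      filter_upwards [eventually_ge_atTop t] with s hs
      exact hM (mem_Ici.2 ht) (mem_Ici.2 (ht.trans hs)) hs
    have hbq : b t * q t = h t := by simp only [hq]; have := hb.pos t; field_simp
    rw [hwh, ← mul_div_assoc, div_le_iff₀ (hhpos t), le_div_iff₀ (hhpos t), ← hbq]
    have := hb.pos t
    constructor <;> nlinarith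
  have hfc : Continuous fun t => b t * w t := hb.continuous.mul hwc
  have hne : (Icc 0 T).Nonempty := nonempty_Icc.2 (by linarith)
  obtain ⟨s₁, -, hs₁⟩ := isCompact_Icc.exists_isMinOn hne hfc.continuousOn
  obtain ⟨s₂, -, hs₂⟩ := isCompact_Icc.exists_isMaxOn hne hfc.continuousOn
  refine ⟨w, min (2 / 3) (b s₁ * w s₁), max 2 (b s₂ * w s₂),
    lt_min (by norm_num) (mul_pos (hb.pos _) (hwpos _)), lt_max_of_lt_left (by norm_num), hwd,
    fun t ht => ?_⟩
  rw [div_le_iff₀ (hb.pos t), le_div_iff₀ (hb.pos t), mul_comm (w t)]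
  rcases le_total t T with h1 | h1
  · exact ⟨(min_le_right _ _).trans (hs₁ (mem_Icc.2 ⟨ht, h1⟩)),
      (hs₂ (mem_Icc.2 ⟨ht, h1⟩)).trans (le_max_right _ _)⟩
  · exact ⟨(min_le_left _ _).trans (hlarge t h1).1, (hlarge t h1).2.trans (le_max_left _ _)⟩

end IsEffectiveDamping

/-- Weights `w`, `W` for the energy estimate of `y'' + b y' + μ y = 0`. -/
structure IsDecayWeight (b w W : ℝ → ℝ) : Prop where
  nonneg : ∀ t, 0 ≤ t → 0 ≤ w t
  hasDerivAt : ∀ t, HasDerivAt w (b t * w t - 1) t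
  hasDerivAt_primitive : ∀ t, HasDerivAt W (w t) t
  one_le : ∀ t, 0 ≤ t → 1 ≤ W t
  two_mul_le : ∀ t, 0 ≤ t → 2 * w t ≤ b t * W t
  four_mul_sq_le : ∀ t, 0 ≤ t → 4 * w t ^ 2 ≤ W t

/-- Take W = 1 + c A + ∫ w. As w ≤ D / b, the two domination conditions follow from b² W ≥ 2 D + 4
D². Since W ≥ c (A + ∫ 1/b), this is arranged by A; hence the division by c. -/
theorem IsEffectiveDamping.exists_isDecayWeight {b b' : ℝ → ℝ} {C : ℝ}
    (hb : IsEffectiveDamping b b' C) :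
    ∃ (w W : ℝ → ℝ) (c D : ℝ), 0 < c ∧ 0 < D ∧ IsDecayWeight b w W ∧
      ∀ t, 0 ≤ t → c * (1 + invIntegral b t) ≤ W t ∧ W t ≤ D * (1 + invIntegral b t) := by
  obtain ⟨w, c, D, hc, hD, hwd, hcD⟩ := hb.exists_adjoint_weight
  obtain ⟨A, hA1, hA⟩ := hb.exists_le_sq_mul (K := (2 * D + 4 * D ^ 2) / c) (by positivity)
  have hwc : Continuous w := continuous_iff_continuousAt.2 fun t => (hwd t).continuousAt
  have hic : Continuous fun t => 1 / b t :=
    continuous_const.div hb.continuous fun t => (hb.pos t).ne'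
  have hlow : ∀ t, 0 ≤ t → c * invIntegral b t ≤ ∫ s in (0 : ℝ)..t, w s := fun t ht => by
    rw [invIntegral, ← intervalIntegral.integral_const_mul]
    refine intervalIntegral.integral_mono_on ht ((hic.const_mul c).intervalIntegrable _ _)
      (hwc.intervalIntegrable _ _) fun s hs => ?_
    rw [mul_one_div]
    exact (hcD s hs.1).1
  have hup : ∀ t, 0 ≤ t → ∫ s in (0 : ℝ)..t, w s ≤ D * invIntegral b t := fun t ht => by
    rw [invIntegral, ← intervalIntegral.integral_const_mul]
    refine intervalIntegral.integral_mono_on ht (hwc.intervalIntegrable _ _)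
      ((hic.const_mul D).intervalIntegrable _ _) fun s hs => ?_
    rw [mul_one_div]
    exact (hcD s hs.1).2
  have hmain : ∀ t, 0 ≤ t →
      2 * D + 4 * D ^ 2 ≤ b t ^ 2 * (1 + c * A + ∫ s in (0 : ℝ)..t, w s) := fun t ht => by
    have h1 := hA t ht
    rw [div_le_iff₀ hc] at h1
    refine h1.trans ?_
    rw [mul_assoc]
    gcongr
    linarith [hlow t ht]
  have hwnn : ∀ t, 0 ≤ t → 0 ≤ w t := fun t ht =>
    (div_pos hc (hb.pos t)).le.trans (hcD t ht).1
  have hbw : ∀ t, 0 ≤ t → b t * w t ≤ D := fun t ht => by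
    rw [mul_comm, ← le_div_iff₀ (hb.pos t)]; exact (hcD t ht).2
  refine ⟨w, fun t => 1 + c * A + ∫ s in (0 : ℝ)..t, w s, c, 1 + c * A + D, hc, by positivity,
    ⟨hwnn, hwd, fun t => (hwc.integral_hasStrictDerivAt 0 t).hasDerivAt.const_add _, ?_, ?_, ?_⟩,
    fun t ht => ⟨?_, ?_⟩⟩
  · intro t ht
    have := hlow t ht
    have := mul_nonneg hc.le (hb.invIntegral_nonneg ht)
    nlinarith
  · intro t ht
    have h1 := hmain t ht
    have h2 := hbw t ht
    have hbt := hb.pos t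
    refine le_of_mul_le_mul_left ?_ hbt
    nlinarith [sq_nonneg D]
  · intro t ht
    have h1 := hmain t ht
    have h2 := hbw t ht
    have hbt := hb.pos t
    have h3 : (b t * w t) ^ 2 ≤ D ^ 2 :=
      pow_le_pow_left₀ (mul_nonneg hbt.le (hwnn t ht)) h2 2
    refine le_of_mul_le_mul_left ?_ (by positivity : 0 < b t ^ 2)
    nlinarith
  · have := hlow t ht
    nlinarith
  · have := hup t ht
    have hB := hb.invIntegral_nonneg ht
    have : 0 ≤ c * A * invIntegral b t := by positivity
    nlinarith

/-! ### Energy estimates for the damped oscillator -/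

/-- `(y, z)` solves `y' = z`, `z' = -b z - μ y`. -/
structure IsDampedOscillator (b : ℝ → ℝ) (μ : ℝ) (y z : ℝ → ℝ) : Prop where
  hasDerivAt_fst : ∀ t, HasDerivAt y (z t) t
  hasDerivAt_snd : ∀ t, HasDerivAt z (-(b t * z t) - μ * y t) t

namespace IsDampedOscillator

theorem energy_antitoneOn {b : ℝ → ℝ} {μ : ℝ} {y z : ℝ → ℝ} (hb : ∀ t, 0 < b t)
    (h : IsDampedOscillator b μ y z) :
    AntitoneOn (fun t => μ * y t ^ 2 + z t ^ 2) (Ici 0) := by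
  have hd : ∀ t, HasDerivAt (fun t => μ * y t ^ 2 + z t ^ 2) (-(2 * b t * z t ^ 2)) t := fun t =>
    ((((h.hasDerivAt_fst t).pow 2).const_mul μ).add ((h.hasDerivAt_snd t).pow 2)).congr_deriv
      (by push_cast; ring)
  refine antitoneOn_of_deriv_nonpos (convex_Ici 0)
    (fun t _ => (hd t).continuousAt.continuousWithinAt)
    (fun t _ => (hd t).differentiableAt.differentiableWithinAt) fun t _ => ?_
  rw [(hd t).deriv]
  have := hb t
  have : 0 ≤ 2 * b t * z t ^ 2 := by positivity
  linarith

/-- The equation w' = b w - 1 is made for this: in (w y z)' the terms b w y z cancel, and the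
remaining -y z cancels against the derivative of y² / 2. -/
theorem hasDerivAt_functional {b : ℝ → ℝ} {μ : ℝ} {y z w W : ℝ → ℝ}
    (h : IsDampedOscillator b μ y z) (hw : IsDecayWeight b w W) (t : ℝ) :
    HasDerivAt (fun t => W t * (μ * y t ^ 2 + z t ^ 2) / 2 + w t * (y t * z t) + y t ^ 2 / 2)
      (-(w t * (μ * y t ^ 2 + z t ^ 2)) / 2 + (2 * w t - b t * W t) * z t ^ 2) t := by
  have h1 := h.hasDerivAt_fst t
  have h2 := h.hasDerivAt_snd t
  refine ((((hw.hasDerivAt_primitive t).mul (((h1.pow 2).const_mul μ).add (h2.pow 2))).div_const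
    2).add ((hw.hasDerivAt t).mul (h1.mul h2)) |>.add ((h1.pow 2).div_const 2)).congr_deriv ?_
  simp only [Pi.add_apply, Pi.mul_apply, Pi.pow_apply]
  push_cast
  ring

/-- Integrated form of F' ≤ -w E / 2 when E ≥ e. With e = 0 it gives the decay bound; with e = E(T)
it measures how much F must lose while W grows. -/
theorem functional_add_antitoneOn {b : ℝ → ℝ} {μ : ℝ} {y z w W : ℝ → ℝ}
    (h : IsDampedOscillator b μ y z) (hw : IsDecayWeight b w W) (e : ℝ) (s T : ℝ) (hs : 0 ≤ s)
    (he : ∀ t ∈ Icc s T, e ≤ μ * y t ^ 2 + z t ^ 2) :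
    AntitoneOn (fun t => W t * (μ * y t ^ 2 + z t ^ 2) / 2 + w t * (y t * z t) + y t ^ 2 / 2
      + e / 2 * W t) (Icc s T) := by
  have hd := fun t => (h.hasDerivAt_functional hw t).add
    ((hw.hasDerivAt_primitive t).const_mul (e / 2))
  refine antitoneOn_of_deriv_nonpos (convex_Icc s T)
    (fun t _ => (hd t).continuousAt.continuousWithinAt)
    (fun t _ => (hd t).differentiableAt.differentiableWithinAt) fun t ht => ?_
  have ht' := interior_subset ht
  have ht0 := hs.trans ht'.1
  refine (hd t).deriv.le.trans ?_
  have h1 := mul_le_mul_of_nonneg_left (he t ht') (hw.nonneg t ht0)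
  have h2 := mul_nonneg (sub_nonneg.2 (hw.two_mul_le t ht0)) (sq_nonneg (z t))
  nlinarith

/-- Complete the square: -w y z ≤ w² z² + y² / 4, and 4 w² ≤ W absorbs the first term in W z² / 4.
-/
theorem functional_ge {b : ℝ → ℝ} {μ : ℝ} {y z w W : ℝ → ℝ}
    (hμ : 0 ≤ μ) (hw : IsDecayWeight b w W) {t : ℝ} (ht : 0 ≤ t) :
    W t * (μ * y t ^ 2 + z t ^ 2) / 4 + y t ^ 2 / 4 ≤
      W t * (μ * y t ^ 2 + z t ^ 2) / 2 + w t * (y t * z t) + y t ^ 2 / 2 := by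
  have h1 := mul_le_mul_of_nonneg_right (hw.four_mul_sq_le t ht) (sq_nonneg (z t))
  have h2 := sq_nonneg (w t * z t + y t / 2)
  have h3 : 0 ≤ W t * (μ * y t ^ 2) :=
    mul_nonneg (zero_le_one.trans (hw.one_le t ht)) (by positivity)
  nlinarith

theorem weighted_energy_le {b : ℝ → ℝ} {μ : ℝ} {y z w W : ℝ → ℝ}
    (h : IsDampedOscillator b μ y z) (hμ : 0 ≤ μ) (hw : IsDecayWeight b w W) {t : ℝ}
    (ht : 0 ≤ t) :
    W t * (μ * y t ^ 2 + z t ^ 2) + y t ^ 2 ≤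
      4 * (W 0 + w 0 + 1) * ((1 + μ) * y 0 ^ 2 + z 0 ^ 2) := by
  have h1 := h.functional_add_antitoneOn hw 0 0 t le_rfl (fun s _ => by positivity)
    (left_mem_Icc.2 ht) (right_mem_Icc.2 ht) ht
  have h2 := functional_ge (y := y) (z := z) hμ hw ht
  have hw0 := hw.nonneg 0 le_rfl
  have hW0 := hw.one_le 0 le_rfl
  have h3 : w 0 * (y 0 * z 0) ≤ w 0 * (y 0 ^ 2 + z 0 ^ 2) :=
    mul_le_mul_of_nonneg_left
      (by nlinarith [sq_nonneg (y 0 - z 0), sq_nonneg (y 0), sq_nonneg (z 0)]) hw0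
  have hp1 : 0 ≤ μ * y 0 ^ 2 := by positivity
  have hp2 : 0 ≤ w 0 * (μ * y 0 ^ 2) := by positivity
  have hp3 : 0 ≤ W 0 * (μ * y 0 ^ 2) := by positivity
  have hp4 : 0 ≤ W 0 * z 0 ^ 2 := by positivity
  have hp5 : 0 ≤ W 0 * y 0 ^ 2 := by positivity
  have hp6 : 0 ≤ z 0 ^ 2 := by positivity
  have hp7 : 0 ≤ y 0 ^ 2 := by positivity
  simp only [zero_div, zero_mul, add_zero] at h1
  nlinarith

/-- Split W(t) E(t) as (W(t) - W(s)) E(t) + W(s) E(t). The first part is at most 2 (F(s) - lim F),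
small once s is large; for fixed s the second is at most W(s) N / W(t), which vanishes as W grows.
-/
theorem tendsto_weighted_energy {b : ℝ → ℝ} {μ : ℝ} {y z w W : ℝ → ℝ}
    (h : IsDampedOscillator b μ y z) (hb : ∀ t, 0 < b t) (hμ : 0 ≤ μ)
    (hw : IsDecayWeight b w W) (hW : Tendsto W atTop atTop) :
    Tendsto (fun t => W t * (μ * y t ^ 2 + z t ^ 2)) atTop (𝓝 0) := by
  set N := 4 * (W 0 + w 0 + 1) * ((1 + μ) * y 0 ^ 2 + z 0 ^ 2)
  set E : ℝ → ℝ := fun t => μ * y t ^ 2 + z t ^ 2 with hE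
  have hE0 : ∀ t, 0 ≤ E t := fun t => by positivity
  have hWp : ∀ t, 0 ≤ t → 0 ≤ W t := fun t ht => zero_le_one.trans (hw.one_le t ht)
  have hle : ∀ t, 0 ≤ t → W t * E t ≤ N := fun t ht =>
    (le_add_of_nonneg_right (sq_nonneg (y t))).trans (h.weighted_energy_le hμ hw ht)
  set F : ℝ → ℝ := fun t => W t * E t / 2 + w t * (y t * z t) + y t ^ 2 / 2 with hF
  have hF0 : ∀ t, 0 ≤ t → 0 ≤ F t := fun t ht =>
    (by have := hWp t ht; have := hE0 t; positivity : 0 ≤ W t * E t / 4 + y t ^ 2 / 4).trans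
      (functional_ge hμ hw ht)
  have hstep : ∀ s t, 0 ≤ s → s ≤ t → (W t - W s) * E t ≤ 2 * (F s - F t) := by
    intro s t hs hst
    have := h.functional_add_antitoneOn hw (E t) s t hs (fun r hr =>
      h.energy_antitoneOn hb (mem_Ici.2 (hs.trans hr.1)) (mem_Ici.2 (hs.trans hst)) hr.2)
      (left_mem_Icc.2 hst) (right_mem_Icc.2 hst) hst
    simp only [hF, hE] at this ⊢
    linarith
  have hWm : ∀ s t, 0 ≤ s → s ≤ t → W s ≤ W t := fun s t hs hst =>
    monotoneOn_of_deriv_nonneg (convex_Ici 0)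
      (fun t _ => (hw.hasDerivAt_primitive t).continuousAt.continuousWithinAt)
      (fun t _ => (hw.hasDerivAt_primitive t).differentiableAt.differentiableWithinAt)
      (fun t ht => by
        rw [(hw.hasDerivAt_primitive t).deriv]
        exact hw.nonneg t (interior_subset ht))
      (mem_Ici.2 hs) (mem_Ici.2 (hs.trans hst)) hst
  have hFm : ∀ s t, 0 ≤ s → s ≤ t → F t ≤ F s := fun s t hs hst => by
    have h1 := hstep s t hs hst
    have h2 := mul_nonneg (sub_nonneg.2 (hWm s t hs hst)) (hE0 t)
    linarith
  have hFlim : ∃ L, Tendsto (fun t => F (max t 0)) atTop (𝓝 L) :=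
    ⟨_, tendsto_atTop_ciInf (f := fun t => F (max t 0))
      (fun s t hst => hFm _ _ (le_max_right _ _) (max_le_max_right _ hst))
      ⟨0, by rintro _ ⟨t, rfl⟩; exact hF0 _ (le_max_right _ _)⟩⟩
  obtain ⟨L, hL⟩ := hFlim
  have hLge : ∀ t, 0 ≤ t → L ≤ F t := fun t ht => by
    refine le_of_tendsto hL ?_
    filter_upwards [eventually_ge_atTop t] with s hs
    exact hFm t _ ht (hs.trans (le_max_left _ _))
  rw [Metric.tendsto_nhds]
  intro ε hε
  obtain ⟨s, hs⟩ := ((hL.eventually_lt_const (lt_add_of_pos_right L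
    (by positivity : 0 < ε / 4))).and (eventually_ge_atTop 0)).exists
  rw [max_eq_left hs.2] at hs
  obtain ⟨hsL, hs0⟩ := hs
  filter_upwards [eventually_ge_atTop s, hW.eventually_gt_atTop (W s * N / (ε / 2))]
    with t hst htW
  have ht0 := hs0.trans hst
  have h1 := hstep s t hs0 hst
  have h2 := hLge t ht0
  have h3 : W s * E t < ε / 2 := by
    have hW1 := hw.one_le t ht0
    have h4 := mul_le_mul_of_nonneg_left (hle t ht0) (hWp s hs0)
    rw [div_lt_iff₀ (by positivity)] at htW
    refine lt_of_mul_lt_mul_left (a := W t) ?_ (hWp t ht0)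
    nlinarith
  rw [Real.dist_eq, sub_zero, abs_of_nonneg (mul_nonneg (hWp t ht0) (hE0 t))]
  linarith

/-- The quantity y + w z would be conserved at μ = 0. Its total loss is at most μ Y W(t), where Y
bounds y, and κ = 1 / (2 Y) limits this loss to 1/2. -/
theorem exists_weighted_energy_ge {b w W : ℝ → ℝ} (hw : IsDecayWeight b w W) :
    ∃ κ : ℝ, 0 < κ ∧ κ ≤ 1 ∧ ∀ (μ : ℝ) (y z : ℝ → ℝ) (t : ℝ), 0 ≤ t → 0 ≤ μ →
      IsDampedOscillator b μ y z → y 0 = 1 → z 0 = 0 → κ / 2 ≤ W t * μ → W t * μ ≤ κ →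
      κ / 32 ≤ W t * (μ * y t ^ 2 + z t ^ 2) := by
  have hw0 := hw.nonneg 0 le_rfl
  have hW0 := hw.one_le 0 le_rfl
  set K := 8 * (W 0 + w 0 + 1)
  have hK : 1 ≤ K := by simp only [K]; linarith
  set Y := K
  refine ⟨1 / (2 * Y), by positivity, ?_, fun μ y z t ht hμ h hy hz hl hu => ?_⟩
  · rw [div_le_one (by positivity)]; linarith
  set κ := 1 / (2 * Y)
  have hκY : κ * Y = 1 / 2 := by simp only [κ]; field_simp
  have hκ1 : κ ≤ 1 := by nlinarith
  have hWt := hw.one_le t ht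
  have hμ1 : μ ≤ 1 := by nlinarith
  -- The energy estimate gives y² ≤ K, and K ≥ 1 then gives y ≤ K without a square root.
  have hyY : ∀ s, 0 ≤ s → y s ≤ Y := fun s hs => by
    have h1 := h.weighted_energy_le hμ hw hs
    rw [hy, hz] at h1
    have h2 : 0 ≤ W s * (μ * y s ^ 2 + z s ^ 2) :=
      mul_nonneg (zero_le_one.trans (hw.one_le s hs)) (by positivity)
    refine (le_abs_self _).trans (abs_le_of_sq_le_sq ?_ (by positivity))
    have h3 : y s ^ 2 ≤ K := by simp only [K]; nlinarith
    nlinarith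
  have hd : ∀ s, HasDerivAt (fun s => y s + w s * z s + μ * Y * W s) (μ * w s * (Y - y s)) s :=
    fun s => (((h.hasDerivAt_fst s).add ((hw.hasDerivAt s).mul (h.hasDerivAt_snd s))).add
      ((hw.hasDerivAt_primitive s).const_mul (μ * Y))).congr_deriv (by ring)
  have hm : MonotoneOn (fun s => y s + w s * z s + μ * Y * W s) (Ici 0) := by
    refine monotoneOn_of_deriv_nonneg (convex_Ici 0)
      (fun s _ => (hd s).continuousAt.continuousWithinAt)
      (fun s _ => (hd s).differentiableAt.differentiableWithinAt) fun s hs => ?_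
    have hs0 : 0 ≤ s := interior_subset hs
    rw [(hd s).deriv]
    exact mul_nonneg (mul_nonneg hμ (hw.nonneg s hs0)) (sub_nonneg.2 (hyY s hs0))
  have h1 := hm (mem_Ici.2 le_rfl) (mem_Ici.2 ht) ht
  simp only [hy, hz, mul_zero, add_zero] at h1
  have h2 : 0 ≤ μ * Y * W 0 := by positivity
  have h3 : μ * Y * W t ≤ 1 / 2 := by nlinarith
  -- From y + w z ≥ 1/2, one summand is at least 1/4. If it is y, then W μ y² ≥ (κ/2)(1/16); if it
  -- is w z, then W z² ≥ 4 w² z² ≥ 1/4.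
  rcases le_total (1 / 4) (y t) with h4 | h4
  · have h5 : 1 / 16 ≤ y t ^ 2 := by nlinarith
    have h6 : 0 ≤ W t * z t ^ 2 := by positivity
    nlinarith
  · have h5 : 1 / 4 ≤ w t * z t := by linarith
    have h6 : 1 / 16 ≤ w t ^ 2 * z t ^ 2 := by nlinarith
    have h7 := mul_le_mul_of_nonneg_right (hw.four_mul_sq_le t ht) (sq_nonneg (z t))
    have h8 : 0 ≤ W t * (μ * y t ^ 2) := by positivity
    nlinarith

end IsDampedOscillator

/-! ### Tools in `L²` -/

theorem L2_norm_sq_eq_integral {α : Type*} [MeasurableSpace α] {ν : Measure α} (f : Lp ℂ 2 ν) :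
    ‖f‖ ^ 2 = ∫ x, ‖f x‖ ^ 2 ∂ν := by
  have h : ((‖f‖ ^ 2 : ℝ) : ℂ) = ((∫ x, ‖f x‖ ^ 2 ∂ν : ℝ) : ℂ) := by
    have := inner_self_eq_norm_sq_to_K (𝕜 := ℂ) f
    rw [L2.inner_def] at this
    simp only [inner_self_eq_norm_sq_to_K] at this
    rw [← integral_complex_ofReal]
    push_cast
    exact this.symm
  exact_mod_cast h

theorem L2_integrable_norm_sq {α : Type*} [MeasurableSpace α] {ν : Measure α} (f : Lp ℂ 2 ν) :
    Integrable (fun x => ‖f x‖ ^ 2) ν :=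
  (memLp_two_iff_integrable_sq_norm (Lp.aestronglyMeasurable f)).1 (Lp.memLp f)

/-- Dominated convergence in `L²`. -/
theorem tendsto_toLp_two_of_dominated {α ι : Type*} [MeasurableSpace α] {ν : Measure α}
    {l : Filter ι} [l.IsCountablyGenerated] {F : ι → α → ℂ} {f : α → ℂ} {g : α → ℝ}
    (hF : ∀ i, MemLp (F i) 2 ν) (hf : MemLp f 2 ν) (hg : MemLp g 2 ν)
    (hbound : ∀ᶠ i in l, ∀ᵐ x ∂ν, ‖F i x - f x‖ ≤ g x)
    (hlim : ∀ᵐ x ∂ν, Tendsto (fun i => F i x) l (𝓝 (f x))) :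
    Tendsto (fun i => (hF i).toLp (F i)) l (𝓝 (hf.toLp f)) := by
  rw [tendsto_iff_norm_sub_tendsto_zero]
  have hsq : ∀ i, ‖(hF i).toLp (F i) - hf.toLp f‖ ^ 2 = ∫ x, ‖F i x - f x‖ ^ 2 ∂ν := fun i => by
    rw [← MemLp.toLp_sub, L2_norm_sq_eq_integral]
    refine integral_congr_ae ?_
    filter_upwards [((hF i).sub hf).coeFn_toLp] with x hx
    rw [hx, Pi.sub_apply]
  have hlim2 : Tendsto (fun i => ∫ x, ‖F i x - f x‖ ^ 2 ∂ν) l (𝓝 (∫ _, (0 : ℝ) ∂ν)) := by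
    refine tendsto_integral_filter_of_dominated_convergence (fun x => g x ^ 2)
      (Eventually.of_forall fun i => ((hF i).sub hf).1.norm.pow 2) ?_ hg.integrable_sq ?_
    · filter_upwards [hbound] with i hi
      filter_upwards [hi] with x hx
      rw [Real.norm_eq_abs, abs_of_nonneg (by positivity)]
      exact pow_le_pow_left₀ (norm_nonneg _) hx 2
    · filter_upwards [hlim] with x hx
      have := ((tendsto_iff_norm_sub_tendsto_zero.1 hx).pow 2)
      simpa using this
  rw [integral_zero] at hlim2
  have := hlim2.sqrt
  rw [Real.sqrt_zero] at this
  refine this.congr fun i => ?_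
  rw [← hsq, Real.sqrt_sq (norm_nonneg _)]

/-- Multiplication by a bounded real function on `L²`. -/
theorem exists_L2_mul {α : Type*} [MeasurableSpace α] {ν : Measure α} {m : α → ℝ} {C : ℝ}
    (hm : AEStronglyMeasurable m ν) (hC : ∀ x, |m x| ≤ C) :
    ∃ M : Lp ℂ 2 ν →L[ℂ] Lp ℂ 2 ν, ∀ f, M f =ᵐ[ν] fun x => (m x : ℂ) * f x := by
  have hmem : ∀ f : Lp ℂ 2 ν, MemLp (fun x => (m x : ℂ) * f x) 2 ν := fun f => by
    refine MemLp.of_le_mul (c := C) (Lp.memLp f) ?_ (Eventually.of_forall fun x => ?_)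
    · exact (Complex.continuous_ofReal.comp_aestronglyMeasurable hm).mul
        (Lp.aestronglyMeasurable f)
    · rw [norm_mul, Complex.norm_real, Real.norm_eq_abs]
      exact mul_le_mul_of_nonneg_right (hC x) (norm_nonneg _)
  let L : Lp ℂ 2 ν →ₗ[ℂ] Lp ℂ 2 ν :=
    { toFun := fun f => (hmem f).toLp _
      map_add' := fun f g => by
        rw [← MemLp.toLp_add]
        refine MemLp.toLp_congr _ _ ?_
        filter_upwards [Lp.coeFn_add f g] with x hx
        rw [hx, Pi.add_apply, Pi.add_apply, mul_add]
      map_smul' := fun c f => by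
        rw [RingHom.id_apply, ← MemLp.toLp_const_smul]
        refine MemLp.toLp_congr _ _ ?_
        filter_upwards [Lp.coeFn_smul c f] with x hx
        rw [hx, Pi.smul_apply, Pi.smul_apply, smul_eq_mul, smul_eq_mul, mul_left_comm] }
  refine ⟨L.mkContinuous C fun f => ?_, fun f => (hmem f).coeFn_toLp⟩
  refine Lp.norm_le_mul_norm_of_ae_le_mul ?_
  filter_upwards [(hmem f).coeFn_toLp] with x hx
  change ‖((hmem f).toLp _ : Lp ℂ 2 ν) x‖ ≤ _
  rw [hx, norm_mul, Complex.norm_real, Real.norm_eq_abs]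
  exact mul_le_mul_of_nonneg_right (hC x) (norm_nonneg _)

/-! ### `L²` functions as tempered distributions -/

section Pairing

variable {n : ℕ}

theorem L2_toTemperedDistribution_injective {f g : L2 n}
    (h : ∀ ψ : 𝓢(EuclideanSpace ℝ (Fin n), ℂ),
      (f : 𝓢'(EuclideanSpace ℝ (Fin n), ℂ)) ψ = (g : 𝓢'(EuclideanSpace ℝ (Fin n), ℂ)) ψ) :
    f = g := by
  have hinj := LinearMap.ker_eq_bot.1 (Lp.ker_toTemperedDistributionCLM_eq_bot (F := ℂ)
    (μ := (volume : Measure (EuclideanSpace ℝ (Fin n)))) (p := 2))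
  refine hinj ?_
  ext ψ
  exact h ψ

theorem toTemperedDistribution_of_ae_mul {m : EuclideanSpace ℝ (Fin n) → ℝ}
    (hm : (fun ξ => (m ξ : ℂ)).HasTemperateGrowth) {f g : L2 n}
    (h : ∀ᵐ ξ, g ξ = (m ξ : ℂ) * f ξ) (ψ : 𝓢(EuclideanSpace ℝ (Fin n), ℂ)) :
    (g : 𝓢'(EuclideanSpace ℝ (Fin n), ℂ)) ψ =
      (f : 𝓢'(EuclideanSpace ℝ (Fin n), ℂ))
        (SchwartzMap.smulLeftCLM ℂ (fun ξ => (m ξ : ℂ)) ψ) := by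
  rw [Lp.toTemperedDistribution_apply, Lp.toTemperedDistribution_apply]
  refine integral_congr_ae ?_
  filter_upwards [h] with ξ hξ
  rw [hξ, SchwartzMap.smulLeftCLM_apply_apply hm]
  simp only [smul_eq_mul]
  ring

theorem toTemperedDistribution_fourier (u : L2 n) (ψ : 𝓢(EuclideanSpace ℝ (Fin n), ℂ)) :
    (u : 𝓢'(EuclideanSpace ℝ (Fin n), ℂ)) (𝓕 ψ) =
      ((𝓕 u : L2 n) : 𝓢'(EuclideanSpace ℝ (Fin n), ℂ)) ψ := by
  rw [← Lp.fourier_toTemperedDistribution_eq]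
  rfl

/-- The symbol of `-Δ`. -/
noncomputable def laplaceSymbol (n : ℕ) (ξ : EuclideanSpace ℝ (Fin n)) : ℝ :=
  (2 * Real.pi * ‖ξ‖) ^ 2

theorem hasTemperateGrowth_laplaceSymbol :
    (fun ξ => (laplaceSymbol n ξ : ℂ)).HasTemperateGrowth := by
  have : (laplaceSymbol n) = fun ξ => (2 * Real.pi) ^ 2 * ‖ξ‖ ^ 2 := by
    funext ξ; simp only [laplaceSymbol]; ring
  rw [this]
  fun_prop

/-- Testing with Fourier transforms of Schwartz functions, which exhaust the Schwartz space, moves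
the equation to the frequency side. -/
theorem laplacian_fourier_apply (u : L2 n) (ψ : 𝓢(EuclideanSpace ℝ (Fin n), ℂ)) :
    (Δ (u : 𝓢'(EuclideanSpace ℝ (Fin n), ℂ))) (𝓕 ψ) =
      -((𝓕 u : L2 n) : 𝓢'(EuclideanSpace ℝ (Fin n), ℂ))
        (SchwartzMap.smulLeftCLM ℂ (fun ξ => (laplaceSymbol n ξ : ℂ)) ψ) := by
  rw [TemperedDistribution.laplacian_eq_fourierMultiplierCLM,
    ← Lp.fourier_toTemperedDistribution_eq]
  have h1 : (fun ξ : EuclideanSpace ℝ (Fin n) => ((‖ξ‖ ^ 2 : ℝ) : ℂ)).HasTemperateGrowth := by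
    fun_prop
  have h2 : SchwartzMap.smulLeftCLM ℂ (fun ξ => (laplaceSymbol n ξ : ℂ)) ψ =
      (((2 * Real.pi) ^ 2 : ℝ) : ℂ) • SchwartzMap.smulLeftCLM ℂ
        (fun ξ : EuclideanSpace ℝ (Fin n) => ((‖ξ‖ ^ 2 : ℝ) : ℂ)) ψ := by
    ext ξ
    rw [_root_.smul_apply, SchwartzMap.smulLeftCLM_apply_apply h1,
      SchwartzMap.smulLeftCLM_apply_apply hasTemperateGrowth_laplaceSymbol]
    simp only [laplaceSymbol, smul_eq_mul]
    push_cast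
    ring
  have h3 : (-(2 * Real.pi) ^ 2 • TemperedDistribution.fourierMultiplierCLM ℂ
      (fun ξ : EuclideanSpace ℝ (Fin n) => ((‖ξ‖ ^ 2 : ℝ) : ℂ))
      (u : 𝓢'(EuclideanSpace ℝ (Fin n), ℂ))) (𝓕 ψ) =
      -(((2 * Real.pi) ^ 2 : ℝ) : ℂ) • (TemperedDistribution.fourierMultiplierCLM ℂ
      (fun ξ : EuclideanSpace ℝ (Fin n) => ((‖ξ‖ ^ 2 : ℝ) : ℂ))
      (u : 𝓢'(EuclideanSpace ℝ (Fin n), ℂ))) (𝓕 ψ) := by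
    simp
  rw [h2, map_smul]
  refine h3.trans ?_
  rw [TemperedDistribution.fourierMultiplierCLM_apply_apply,
    FourierTransform.fourierInv_fourier_eq, neg_smul]
  rfl

/-- A weak derivative that is continuous with values in `L²` is a derivative in `L²`. -/
theorem hasDerivWithinAt_of_weak {V R : ℝ → L2 n} (hR : ContinuousOn R (Ici 0))
    (h : ∀ ψ : 𝓢(EuclideanSpace ℝ (Fin n), ℂ), ∀ t, 0 ≤ t →
      HasDerivWithinAt (fun s => (V s : 𝓢'(EuclideanSpace ℝ (Fin n), ℂ)) ψ)
        ((R t : 𝓢'(EuclideanSpace ℝ (Fin n), ℂ)) ψ) (Ici 0) t) {t : ℝ} (ht : 0 ≤ t) :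
    HasDerivWithinAt V (R t) (Ici 0) t := by
  set R' : ℝ → L2 n := fun t => R (max t 0)
  have hR' : Continuous R' :=
    hR.comp_continuous (by fun_prop) fun t => mem_Ici.2 (le_max_right _ _)
  set W : ℝ → L2 n := fun t => V 0 + ∫ s in (0 : ℝ)..t, R' s
  have hWd : ∀ t, HasDerivAt W (R' t) t := fun t =>
    (hR'.integral_hasStrictDerivAt 0 t).hasDerivAt.const_add _
  have hRR : ∀ t, 0 ≤ t → R' t = R t := fun t ht => by simp only [R', max_eq_left ht]
  -- Paired with any test function, V minus the primitive of R has zero derivative and zero initial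
  -- value; pairings separate points of L².
  have key : ∀ t, 0 ≤ t → V t = W t := fun t ht => by
    refine L2_toTemperedDistribution_injective fun ψ => ?_
    let ℓ : L2 n →L[ℂ] ℂ := (PointwiseConvergenceCLM.evalCLM (RingHom.id ℂ) ℂ ψ).comp
      (Lp.toTemperedDistributionCLM ℂ volume 2)
    have hℓ : ∀ f : L2 n, (f : 𝓢'(EuclideanSpace ℝ (Fin n), ℂ)) ψ = ℓ f := fun f => rfl
    have hd : ∀ s, 0 ≤ s → HasDerivWithinAt (fun s => ℓ (V s) - ℓ (W s)) 0 (Ici 0) s := by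
      intro s hs
      have h1 := h ψ s hs
      have h2 : HasDerivWithinAt (fun s => ℓ (W s)) (ℓ (R' s)) (Ici 0) s :=
        ((ℓ.restrictScalars ℝ).hasFDerivAt.comp_hasDerivAt s (hWd s)).hasDerivWithinAt
      rw [hRR s hs] at h2
      exact (h1.sub h2).congr_deriv (sub_self _)
    have hc := (convex_Ici (0 : ℝ)).norm_image_sub_le_of_norm_hasDerivWithin_le (C := 0)
      (fun s hs => hd s hs) (fun s _ => by simp) (mem_Ici.2 le_rfl) (mem_Ici.2 ht)
    have hW0 : W 0 = V 0 := by simp [W]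
    rw [zero_mul, hW0, sub_self, sub_zero] at hc
    rw [hℓ, hℓ]
    exact sub_eq_zero.1 (norm_le_zero_iff.1 hc)
  rw [← hRR t ht]
  exact (hWd t).hasDerivWithinAt.congr (fun s hs => key s hs) (key t ht)

end Pairing

/-! ### Uniqueness of energy solutions -/

section Uniqueness

variable {n : ℕ}

theorem L2_real_smul (r : ℝ) (f : L2 n) : r • f = (r : ℂ) • f := by
  refine Lp.ext ?_
  filter_upwards [Lp.coeFn_smul r f, Lp.coeFn_smul (r : ℂ) f] with x h1 h2
  rw [h1, h2, Pi.smul_apply, Pi.smul_apply, Complex.coe_smul]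

/-- Uniqueness for the Fourier transformed equation in `L²`. -/
theorem fourierSide_unique {b : ℝ → ℝ} (hbc : ContinuousOn b (Ici 0))
    (hb : ∀ t, 0 ≤ t → 0 ≤ b t) {U V : ℝ → L2 n}
    (hU : ∀ t, 0 ≤ t → HasDerivWithinAt U (V t) (Ici 0) t) (hV : ContinuousOn V (Ici 0))
    (heq : ∀ ψ : 𝓢(EuclideanSpace ℝ (Fin n), ℂ), ∀ t, 0 ≤ t →
      HasDerivWithinAt (fun s => (V s : 𝓢'(EuclideanSpace ℝ (Fin n), ℂ)) ψ)
        (-(U t : 𝓢'(EuclideanSpace ℝ (Fin n), ℂ))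
            (SchwartzMap.smulLeftCLM ℂ (fun ξ => (laplaceSymbol n ξ : ℂ)) ψ)
          - (b t : ℂ) * (V t : 𝓢'(EuclideanSpace ℝ (Fin n), ℂ)) ψ) (Ici 0) t)
    (hU0 : U 0 = 0) (hV0 : V 0 = 0) {t : ℝ} (ht : 0 ≤ t) :
    V t = 0 ∧ ∀ᵐ ξ, (absSymbol n ξ : ℂ) * U t ξ = 0 := by
  -- V is differentiable only in the weak sense, so its energy cannot be differentiated directly.
  -- The factor m makes the symbol of -Δ bounded, so m V is differentiable in L²; being positive, m
  -- loses no information.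
  set m : EuclideanSpace ℝ (Fin n) → ℝ := fun ξ => (1 + ‖ξ‖ ^ 2) ^ (-1 : ℝ) with hm
  have hmeq : ∀ ξ, m ξ = (1 + ‖ξ‖ ^ 2)⁻¹ := fun ξ => Real.rpow_neg_one _
  have hmpos : ∀ ξ, 0 < m ξ := fun ξ => by rw [hmeq]; positivity
  have hmg : (fun ξ => (m ξ : ℂ)).HasTemperateGrowth := by
    have := Function.hasTemperateGrowth_one_add_norm_sq_rpow
      (EuclideanSpace ℝ (Fin n)) (-1)
    fun_prop
  have hmc : Continuous m := by
    have : m = fun ξ => (1 + ‖ξ‖ ^ 2)⁻¹ := funext hmeq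
    rw [this]
    exact (by fun_prop : Continuous fun ξ : EuclideanSpace ℝ (Fin n) => 1 + ‖ξ‖ ^ 2).inv₀
      fun ξ => by positivity
  have hac : Continuous (absSymbol n) := by unfold absSymbol; fun_prop
  have hlc : Continuous (laplaceSymbol n) := by unfold laplaceSymbol; fun_prop
  have hb0 : ∀ ξ, |m ξ| ≤ 1 := fun ξ => by
    rw [abs_of_pos (hmpos ξ), hmeq]
    exact inv_le_one_of_one_le₀ (by nlinarith [sq_nonneg ‖ξ‖])
  have hb1 : ∀ ξ, |absSymbol n ξ * m ξ| ≤ 2 * Real.pi := fun ξ => by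
    have hp := Real.pi_pos
    rw [abs_of_nonneg (mul_nonneg (by unfold absSymbol; positivity) (hmpos ξ).le), hmeq,
      ← div_eq_mul_inv, div_le_iff₀ (by positivity)]
    unfold absSymbol
    have : ‖ξ‖ ≤ 1 + ‖ξ‖ ^ 2 := by nlinarith [sq_nonneg (‖ξ‖ - 1)]
    gcongr
  have hb2 : ∀ ξ, |laplaceSymbol n ξ * m ξ| ≤ (2 * Real.pi) ^ 2 := fun ξ => by
    have hp := Real.pi_pos
    rw [abs_of_nonneg (mul_nonneg (by unfold laplaceSymbol; positivity) (hmpos ξ).le), hmeq,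
      ← div_eq_mul_inv, div_le_iff₀ (by positivity)]
    unfold laplaceSymbol
    rw [mul_pow]
    have : ‖ξ‖ ^ 2 ≤ 1 + ‖ξ‖ ^ 2 := by linarith
    gcongr
  obtain ⟨M₀, hM₀⟩ := exists_L2_mul (ν := (volume : Measure (EuclideanSpace ℝ (Fin n))))
    hmc.aestronglyMeasurable hb0
  obtain ⟨M₁, hM₁⟩ := exists_L2_mul (ν := (volume : Measure (EuclideanSpace ℝ (Fin n))))
    (hac.mul hmc).aestronglyMeasurable hb1
  obtain ⟨M₂, hM₂⟩ := exists_L2_mul (ν := (volume : Measure (EuclideanSpace ℝ (Fin n))))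
    (hlc.mul hmc).aestronglyMeasurable hb2
  have hUc : ContinuousOn U (Ici 0) := fun t ht => (hU t ht).continuousWithinAt
  set R : ℝ → L2 n := fun t => -(M₂ (U t)) - (b t : ℂ) • M₀ (V t) with hR
  have hRc : ContinuousOn R (Ici 0) :=
    (M₂.continuous.comp_continuousOn hUc).neg.sub
      ((Complex.continuous_ofReal.comp_continuousOn hbc).smul (M₀.continuous.comp_continuousOn hV))
  have hdV : ∀ t, 0 ≤ t → HasDerivWithinAt (fun s => M₀ (V s)) (R t) (Ici 0) t := by
    intro t ht
    refine hasDerivWithinAt_of_weak hRc (fun ψ s hs => ?_) ht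
    have h1 := heq (SchwartzMap.smulLeftCLM ℂ (fun ξ => (m ξ : ℂ)) ψ) s hs
    have h2 : ∀ r, ((M₀ (V r) : L2 n) : 𝓢'(EuclideanSpace ℝ (Fin n), ℂ)) ψ =
        (V r : 𝓢'(EuclideanSpace ℝ (Fin n), ℂ))
          (SchwartzMap.smulLeftCLM ℂ (fun ξ => (m ξ : ℂ)) ψ) := fun r =>
      toTemperedDistribution_of_ae_mul hmg (hM₀ (V r)) ψ
    have hlm : (fun ξ => ((laplaceSymbol n ξ * m ξ : ℝ) : ℂ)).HasTemperateGrowth := by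
      have h := hasTemperateGrowth_laplaceSymbol (n := n)
      simp only [Complex.ofReal_mul]
      exact h.mul hmg
    have h3 : ((M₂ (U s) : L2 n) : 𝓢'(EuclideanSpace ℝ (Fin n), ℂ)) ψ =
        (U s : 𝓢'(EuclideanSpace ℝ (Fin n), ℂ))
          (SchwartzMap.smulLeftCLM ℂ (fun ξ => (laplaceSymbol n ξ : ℂ))
            (SchwartzMap.smulLeftCLM ℂ (fun ξ => (m ξ : ℂ)) ψ)) := by
      rw [SchwartzMap.smulLeftCLM_smulLeftCLM_apply hasTemperateGrowth_laplaceSymbol hmg,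
        toTemperedDistribution_of_ae_mul hlm (hM₂ (U s)) ψ]
      congr 3
      ext ξ
      simp
    have h4 : (R s : 𝓢'(EuclideanSpace ℝ (Fin n), ℂ)) ψ =
        -((M₂ (U s) : L2 n) : 𝓢'(EuclideanSpace ℝ (Fin n), ℂ)) ψ -
          (b s : ℂ) * ((M₀ (V s) : L2 n) : 𝓢'(EuclideanSpace ℝ (Fin n), ℂ)) ψ := by
      simp only [← Lp.toTemperedDistributionCLM_apply, hR, map_sub, map_neg, map_smul]
      rfl
    rw [h4, h3, h2]
    exact h1.congr (fun r _ => h2 r) (h2 s)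
  have hdX : ∀ t, 0 ≤ t → HasDerivWithinAt (fun s => M₁ (U s)) (M₁ (V t)) (Ici 0) t :=
    fun t ht => (M₁.restrictScalars ℝ).hasFDerivAt.comp_hasDerivWithinAt t (hU t ht)
  -- The symbol |2πξ|² is shared equally between the two factors; this cancels the cross terms and
  -- leaves only the damping loss.
  have hcross : ∀ t, inner ℝ (M₀ (V t)) (M₂ (U t)) = inner ℝ (M₁ (U t)) (M₁ (V t)) := by
    intro t
    rw [L2.inner_def, L2.inner_def]
    refine integral_congr_ae ?_
    filter_upwards [hM₀ (V t), hM₂ (U t), hM₁ (U t), hM₁ (V t)] with ξ h1 h2 h3 h4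
    rw [h1, h2, h3, h4]
    have : laplaceSymbol n ξ = absSymbol n ξ * absSymbol n ξ := by
      simp only [laplaceSymbol, absSymbol]; ring
    simp only [Complex.inner, Pi.mul_apply, this, map_mul, Complex.conj_ofReal, Complex.mul_re,
      Complex.mul_im, Complex.ofReal_re, Complex.ofReal_im, Complex.conj_re, Complex.conj_im]
    ring
  have hde : ∀ t, 0 ≤ t → HasDerivWithinAt (fun s => ‖M₀ (V s)‖ ^ 2 + ‖M₁ (U s)‖ ^ 2)
      (-(2 * b t * ‖M₀ (V t)‖ ^ 2)) (Ici 0) t := by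
    intro t ht
    refine ((hdV t ht).norm_sq.add (hdX t ht).norm_sq).congr_deriv ?_
    have h1 : inner ℝ (M₀ (V t)) (R t) =
        -inner ℝ (M₁ (U t)) (M₁ (V t)) - b t * ‖M₀ (V t)‖ ^ 2 := by
      simp only [hR]
      rw [inner_sub_right, inner_neg_right, hcross, ← L2_real_smul, real_inner_smul_right,
        real_inner_self_eq_norm_sq]
    rw [h1]
    ring
  have hanti : AntitoneOn (fun s => ‖M₀ (V s)‖ ^ 2 + ‖M₁ (U s)‖ ^ 2) (Ici 0) := by
    refine antitoneOn_of_deriv_nonpos (convex_Ici 0)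
      (fun t ht => (hde t ht).continuousWithinAt) (fun t ht => ?_) fun t ht => ?_
    · exact ((hde t (interior_subset ht)).mono interior_subset).differentiableWithinAt
    · have h0 : 0 ≤ t := interior_subset ht
      rw [((hde t h0).hasDerivAt (mem_interior_iff_mem_nhds.1 ht)).deriv]
      have := hb t h0
      have : 0 ≤ 2 * b t * ‖M₀ (V t)‖ ^ 2 := by positivity
      linarith
  have hzero := hanti (mem_Ici.2 le_rfl) (mem_Ici.2 ht) ht
  simp only [hU0, hV0, map_zero, norm_zero] at hzero
  have hz1 : M₀ (V t) = 0 := by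
    have : ‖M₀ (V t)‖ ^ 2 = 0 := by nlinarith [sq_nonneg ‖M₀ (V t)‖, sq_nonneg ‖M₁ (U t)‖]
    simpa using this
  have hz2 : M₁ (U t) = 0 := by
    have : ‖M₁ (U t)‖ ^ 2 = 0 := by nlinarith [sq_nonneg ‖M₀ (V t)‖, sq_nonneg ‖M₁ (U t)‖]
    simpa using this
  constructor
  · rw [Lp.eq_zero_iff_ae_eq_zero]
    have h0 := hM₀ (V t)
    rw [hz1] at h0
    filter_upwards [h0, Lp.coeFn_zero ℂ 2 (volume : Measure (EuclideanSpace ℝ (Fin n)))]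
      with ξ h1 h2
    rw [h2, Pi.zero_apply] at h1
    rcases mul_eq_zero.1 h1.symm with h | h
    · exact absurd (Complex.ofReal_eq_zero.1 h) (hmpos ξ).ne'
    · exact h
  · have h0 := hM₁ (U t)
    rw [hz2] at h0
    filter_upwards [h0, Lp.coeFn_zero ℂ 2 (volume : Measure (EuclideanSpace ℝ (Fin n)))]
      with ξ h1 h2
    rw [h2, Pi.zero_apply] at h1
    have h3 : (m ξ : ℂ) * ((absSymbol n ξ : ℂ) * U t ξ) = 0 := by
      refine Eq.trans ?_ h1.symm
      rw [Pi.mul_apply]; push_cast; ring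
    rcases mul_eq_zero.1 h3 with h | h
    · exact absurd (Complex.ofReal_eq_zero.1 h) (hmpos ξ).ne'
    · exact h

theorem IsFourierMultiplier.add {m : EuclideanSpace ℝ (Fin n) → ℝ} {f f' g g' : L2 n}
    (h : IsFourierMultiplier m f g) (h' : IsFourierMultiplier m f' g') :
    IsFourierMultiplier m (f + f') (g + g') := by
  unfold IsFourierMultiplier at *
  rw [FourierTransform.fourier_add, FourierTransform.fourier_add]
  filter_upwards [h, h', Lp.coeFn_add (𝓕 f : L2 n) (𝓕 f' : L2 n),
    Lp.coeFn_add (𝓕 g : L2 n) (𝓕 g' : L2 n)] with ξ h1 h2 h3 h4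
  rw [h3, h4, Pi.add_apply, Pi.add_apply, h1, h2, mul_add]

theorem IsFourierMultiplier.const_smul {m : EuclideanSpace ℝ (Fin n) → ℝ} {f g : L2 n} (c : ℂ)
    (h : IsFourierMultiplier m f g) : IsFourierMultiplier m (c • f) (c • g) := by
  unfold IsFourierMultiplier at *
  rw [FourierTransform.fourier_smul, FourierTransform.fourier_smul]
  filter_upwards [h, Lp.coeFn_smul c (𝓕 f : L2 n), Lp.coeFn_smul c (𝓕 g : L2 n)] with ξ h1 h3 h4
  rw [h3, h4, Pi.smul_apply, Pi.smul_apply, h1, smul_eq_mul, smul_eq_mul, mul_left_comm]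

theorem SolvesCauchyProblem.add {b : ℝ → ℝ} {f g f' g' : L2 n} {u w v u' w' v' : ℝ → L2 n}
    (h : SolvesCauchyProblem b f g u w v) (h' : SolvesCauchyProblem b f' g' u' w' v') :
    SolvesCauchyProblem b (f + f') (g + g') (fun t => u t + u' t) (fun t => w t + w' t)
      (fun t => v t + v' t) := by
  obtain ⟨h1, h2, h3⟩ := h
  obtain ⟨h1', h2', h3'⟩ := h'
  refine ⟨⟨fun t ht => (h1.absD_eq t ht).add (h1'.absD_eq t ht),
    h1.continuousOn_absDu.add h1'.continuousOn_absDu,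
    fun t ht => (h1.hasDeriv t ht).add (h1'.hasDeriv t ht),
    h1.continuousOn_ut.add h1'.continuousOn_ut, fun φ t ht => ?_⟩, h2.add h2', ?_⟩
  · have hd := (h1.equation φ t ht).add (h1'.equation φ t ht)
    have e : ∀ x y : L2 n, ((x + y : L2 n) : 𝓢'(EuclideanSpace ℝ (Fin n), ℂ)) φ =
        (x : 𝓢'(EuclideanSpace ℝ (Fin n), ℂ)) φ + (y : 𝓢'(EuclideanSpace ℝ (Fin n), ℂ)) φ :=
      fun x y => by simp only [← Lp.toTemperedDistributionCLM_apply, map_add]; rfl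
    refine (hd.congr (fun s _ => e _ _) (e _ _)).congr_deriv ?_
    simp only [TemperedDistribution.laplacian_apply_apply]
    rw [e, ← Lp.toTemperedDistributionCLM_apply (u t + u' t), map_add]
    simp only [Lp.toTemperedDistributionCLM_apply, add_apply]
    ring
  · rw [smul_add, h3, h3']

theorem SolvesCauchyProblem.const_smul {b : ℝ → ℝ} {f g : L2 n} {u w v : ℝ → L2 n} (c : ℂ)
    (h : SolvesCauchyProblem b f g u w v) :
    SolvesCauchyProblem b (c • f) (c • g) (fun t => c • u t) (fun t => c • w t)
      (fun t => c • v t) := by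
  obtain ⟨h1, h2, h3⟩ := h
  refine ⟨⟨fun t ht => (h1.absD_eq t ht).const_smul c, h1.continuousOn_absDu.const_smul c,
    fun t ht => (h1.hasDeriv t ht).const_smul c, h1.continuousOn_ut.const_smul c,
    fun φ t ht => ?_⟩, h2.const_smul c, ?_⟩
  · have hd := (h1.equation φ t ht).const_smul c
    have e : ∀ x : L2 n, ((c • x : L2 n) : 𝓢'(EuclideanSpace ℝ (Fin n), ℂ)) φ =
        c • (x : 𝓢'(EuclideanSpace ℝ (Fin n), ℂ)) φ :=
      fun x => by simp only [← Lp.toTemperedDistributionCLM_apply, map_smul]; rfl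
    refine (hd.congr (fun s _ => e _) (e _)).congr_deriv ?_
    simp only [TemperedDistribution.laplacian_apply_apply]
    rw [e, ← Lp.toTemperedDistributionCLM_apply (c • u t), map_smul]
    simp only [Lp.toTemperedDistributionCLM_apply, smul_apply, smul_eq_mul]
    ring
  · rw [smul_comm, h3]

theorem fourier_L2_eq_zero_iff {f : L2 n} : (𝓕 f : L2 n) = 0 ↔ f = 0 := by
  rw [← norm_eq_zero, Lp.norm_fourier_eq, norm_eq_zero]

theorem SolvesCauchyProblem.eq_zero {b : ℝ → ℝ} (hbc : ContinuousOn b (Ici 0))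
    (hb : ∀ t, 0 ≤ t → 0 ≤ b t) {u w v : ℝ → L2 n}
    (h : SolvesCauchyProblem b 0 0 u w v) {t : ℝ} (ht : 0 ≤ t) : w t = 0 ∧ v t = 0 := by
  obtain ⟨h1, h2, h3⟩ := h
  have hF0 : (𝓕 (0 : L2 n) : L2 n) = 0 := fourier_L2_eq_zero_iff.2 rfl
  have hv0 : v 0 = 0 := by simpa using h3
  have hU0 : (𝓕 (u 0) : L2 n) = 0 := by
    rw [Lp.eq_zero_iff_ae_eq_zero]
    unfold IsFourierMultiplier at h2
    rw [hF0] at h2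
    filter_upwards [h2, Lp.coeFn_zero ℂ 2 (volume : Measure (EuclideanSpace ℝ (Fin n)))]
      with ξ h4 h5
    rw [h5, Pi.zero_apply] at h4
    rcases mul_eq_zero.1 h4.symm with h | h
    · have : 0 < japaneseSymbol n ξ := Real.sqrt_pos.2 (by positivity)
      exact absurd (Complex.ofReal_eq_zero.1 h) this.ne'
    · exact h
  have hkey := fourierSide_unique (n := n) hbc hb (U := fun t => (𝓕 (u t) : L2 n))
    (V := fun t => (𝓕 (v t) : L2 n))
    (fun t ht => (((Lp.fourierTransformₗᵢ (EuclideanSpace ℝ (Fin n)) ℂ).toContinuousLinearEquiv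
      : L2 n →L[ℂ] L2 n).restrictScalars ℝ).hasFDerivAt.comp_hasDerivWithinAt t
        (h1.hasDeriv t ht))
    ((Lp.fourierTransformₗᵢ (EuclideanSpace ℝ (Fin n)) ℂ).continuous.comp_continuousOn
      h1.continuousOn_ut)
    (fun ψ t ht => by
      have := h1.equation (𝓕 ψ) t ht
      rw [laplacian_fourier_apply, toTemperedDistribution_fourier] at this
      exact this.congr (fun s _ => (toTemperedDistribution_fourier _ _).symm)
        (toTemperedDistribution_fourier _ _).symm)
    hU0 (by simp only [hv0]; exact hF0) ht
  refine ⟨?_, fourier_L2_eq_zero_iff.1 hkey.1⟩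
  rw [← fourier_L2_eq_zero_iff, Lp.eq_zero_iff_ae_eq_zero]
  filter_upwards [h1.absD_eq t ht, hkey.2] with ξ h4 h5
  rw [h4, h5, Pi.zero_apply]

theorem SolvesCauchyProblem.unique {b : ℝ → ℝ} (hbc : ContinuousOn b (Ici 0))
    (hb : ∀ t, 0 ≤ t → 0 ≤ b t) {f g : L2 n} {u w v u' w' v' : ℝ → L2 n}
    (h : SolvesCauchyProblem b f g u w v) (h' : SolvesCauchyProblem b f g u' w' v') {t : ℝ}
    (ht : 0 ≤ t) : w t = w' t ∧ v t = v' t := by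
  have hd := h.add (h'.const_smul (-1))
  rw [neg_one_smul, neg_one_smul, add_neg_cancel, add_neg_cancel] at hd
  have := hd.eq_zero hbc hb ht
  simp only [neg_one_smul, ← sub_eq_add_neg, sub_eq_zero] at this
  exact this

end Uniqueness

/-! ### Complex valued solutions of the damped oscillator -/

/-- `(y, z)` is a complex valued solution of `y' = z`, `z' = -b z - μ y`. -/
structure IsComplexOscillator (b : ℝ → ℝ) (μ : ℝ) (y z : ℝ → ℂ) : Prop where
  hasDerivAt_fst : ∀ t, HasDerivAt y (z t) t
  hasDerivAt_snd : ∀ t, HasDerivAt z (-((b t : ℂ) * z t) - (μ : ℂ) * y t) t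

namespace IsComplexOscillator

theorem re {b : ℝ → ℝ} {μ : ℝ} {y z : ℝ → ℂ} (h : IsComplexOscillator b μ y z) :
    IsDampedOscillator b μ (fun t => (y t).re) (fun t => (z t).re) where
  hasDerivAt_fst t := Complex.reCLM.hasFDerivAt.comp_hasDerivAt t (h.hasDerivAt_fst t)
  hasDerivAt_snd t := by
    refine (Complex.reCLM.hasFDerivAt.comp_hasDerivAt t (h.hasDerivAt_snd t)).congr_deriv ?_
    simp

theorem im {b : ℝ → ℝ} {μ : ℝ} {y z : ℝ → ℂ} (h : IsComplexOscillator b μ y z) :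
    IsDampedOscillator b μ (fun t => (y t).im) (fun t => (z t).im) where
  hasDerivAt_fst t := Complex.imCLM.hasFDerivAt.comp_hasDerivAt t (h.hasDerivAt_fst t)
  hasDerivAt_snd t := by
    refine (Complex.imCLM.hasFDerivAt.comp_hasDerivAt t (h.hasDerivAt_snd t)).congr_deriv ?_
    simp

theorem norm_sq_eq (z : ℂ) : ‖z‖ ^ 2 = z.re ^ 2 + z.im ^ 2 := by
  rw [Complex.sq_norm, Complex.normSq_apply]; ring

theorem energy_le {b : ℝ → ℝ} {μ : ℝ} {y z : ℝ → ℂ} (hb : ∀ t, 0 < b t)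
    (h : IsComplexOscillator b μ y z) {t : ℝ} (ht : 0 ≤ t) :
    μ * ‖y t‖ ^ 2 + ‖z t‖ ^ 2 ≤ μ * ‖y 0‖ ^ 2 + ‖z 0‖ ^ 2 := by
  have h1 := h.re.energy_antitoneOn hb (mem_Ici.2 le_rfl) (mem_Ici.2 ht) ht
  have h2 := h.im.energy_antitoneOn hb (mem_Ici.2 le_rfl) (mem_Ici.2 ht) ht
  simp only [norm_sq_eq] at *
  linarith

theorem weighted_energy_le {b : ℝ → ℝ} {μ : ℝ} {y z : ℝ → ℂ} {w W : ℝ → ℝ}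
    (h : IsComplexOscillator b μ y z) (hμ : 0 ≤ μ) (hw : IsDecayWeight b w W) {t : ℝ}
    (ht : 0 ≤ t) :
    W t * (μ * ‖y t‖ ^ 2 + ‖z t‖ ^ 2) ≤
      4 * (W 0 + w 0 + 1) * ((1 + μ) * ‖y 0‖ ^ 2 + ‖z 0‖ ^ 2) := by
  have h1 := h.re.weighted_energy_le hμ hw ht
  have h2 := h.im.weighted_energy_le hμ hw ht
  simp only [norm_sq_eq] at *
  nlinarith [sq_nonneg (y t).re, sq_nonneg (y t).im]

theorem tendsto_weighted_energy {b : ℝ → ℝ} {μ : ℝ} {y z : ℝ → ℂ} {w W : ℝ → ℝ}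
    (h : IsComplexOscillator b μ y z) (hb : ∀ t, 0 < b t) (hμ : 0 ≤ μ)
    (hw : IsDecayWeight b w W) (hW : Tendsto W atTop atTop) :
    Tendsto (fun t => W t * (μ * ‖y t‖ ^ 2 + ‖z t‖ ^ 2)) atTop (𝓝 0) := by
  have := (h.re.tendsto_weighted_energy hb hμ hw hW).add
    (h.im.tendsto_weighted_energy hb hμ hw hW)
  rw [add_zero] at this
  refine this.congr fun t => ?_
  simp only [norm_sq_eq]
  ring

end IsComplexOscillator

/-- One-sided differentiation under the integral sign. -/
theorem hasDerivWithinAt_integral_Ici {α : Type*} [MeasurableSpace α] {ν : Measure α}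
    {A A' : ℝ → α → ℂ} {g : α → ℝ} {t : ℝ} (ht : 0 ≤ t)
    (hA : ∀ s, 0 ≤ s → Integrable (A s) ν)
    (hd : ∀ x s, 0 ≤ s → HasDerivAt (fun r => A r x) (A' s x) s)
    (hbound : ∀ s, 0 ≤ s → s ≤ t + 1 → ∀ x, ‖A' s x‖ ≤ g x) (hg : Integrable g ν) :
    HasDerivWithinAt (fun s => ∫ x, A s x ∂ν) (∫ x, A' t x ∂ν) (Ici 0) t := by
  rw [hasDerivWithinAt_iff_tendsto_slope]
  have hev : ∀ᶠ s in 𝓝[Ici 0 \ {t}] t, 0 ≤ s ∧ s ≤ t + 1 ∧ s ≠ t := by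
    have h1 : ∀ᶠ s in 𝓝[Ici 0 \ {t}] t, s ∈ Ici (0 : ℝ) \ {t} := self_mem_nhdsWithin
    have h2 : ∀ᶠ s in 𝓝[Ici 0 \ {t}] t, s ≤ t + 1 :=
      mem_nhdsWithin_of_mem_nhds (Iic_mem_nhds (lt_add_one t))
    filter_upwards [h1, h2] with s hs hs'
    exact ⟨hs.1, hs', hs.2⟩
  have hlim : Tendsto (fun s => ∫ x, slope (fun r => A r x) t s ∂ν) (𝓝[Ici 0 \ {t}] t)
      (𝓝 (∫ x, A' t x ∂ν)) := by
    refine tendsto_integral_filter_of_dominated_convergence g ?_ ?_ hg ?_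
    · filter_upwards [hev] with s hs
      simp only [slope, vsub_eq_sub]
      exact ((hA s hs.1).sub (hA t ht)).1.const_smul _
    · filter_upwards [hev] with s hs
      refine Eventually.of_forall fun x => ?_
      -- The mean value inequality dominates the difference quotients by g.
      have hmv := (convex_Icc (0 : ℝ) (t + 1)).norm_image_sub_le_of_norm_hasDerivWithin_le
        (f := fun r => A r x) (f' := fun r => A' r x) (C := g x)
        (fun r hr => (hd x r hr.1).hasDerivWithinAt) (fun r hr => hbound r hr.1 hr.2 x)
        (mem_Icc.2 ⟨ht, by linarith⟩) (mem_Icc.2 ⟨hs.1, hs.2.1⟩)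
      have hne : 0 < ‖s - t‖ := norm_pos_iff.2 (sub_ne_zero.2 hs.2.2)
      rw [slope, vsub_eq_sub, norm_smul, norm_inv, inv_mul_le_iff₀ hne, mul_comm]
      exact hmv
    · refine Eventually.of_forall fun x => ?_
      exact hasDerivWithinAt_iff_tendsto_slope.1 (hd x t ht).hasDerivWithinAt
  refine hlim.congr' ?_
  filter_upwards [hev] with s hs
  simp only [slope, vsub_eq_sub]
  rw [integral_smul, integral_sub (hA s hs.1) (hA t ht)]

/-! ### Symbols and pointwise solutions on the frequency side -/

section Existence

variable {n : ℕ}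

theorem laplaceSymbol_nonneg (ξ : EuclideanSpace ℝ (Fin n)) : 0 ≤ laplaceSymbol n ξ := sq_nonneg _

theorem laplaceSymbol_eq_sq (ξ : EuclideanSpace ℝ (Fin n)) :
    laplaceSymbol n ξ = absSymbol n ξ ^ 2 := rfl

theorem absSymbol_nonneg (ξ : EuclideanSpace ℝ (Fin n)) : 0 ≤ absSymbol n ξ := by
  have := Real.pi_pos
  unfold absSymbol
  positivity

theorem japaneseSymbol_pos (ξ : EuclideanSpace ℝ (Fin n)) : 0 < japaneseSymbol n ξ :=
  Real.sqrt_pos.2 (by positivity)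

theorem japaneseSymbol_sq (ξ : EuclideanSpace ℝ (Fin n)) :
    japaneseSymbol n ξ ^ 2 = 1 + laplaceSymbol n ξ :=
  Real.sq_sqrt (by positivity)

theorem continuous_absSymbol : Continuous (absSymbol n) := by unfold absSymbol; fun_prop

theorem continuous_laplaceSymbol : Continuous (laplaceSymbol n) := by
  unfold laplaceSymbol; fun_prop

theorem continuous_japaneseSymbol : Continuous (japaneseSymbol n) := by
  unfold japaneseSymbol; fun_prop

/-- `Y`, `Z` describe on the Fourier side the solution `u` of the Cauchy problem with data `f`, `g`,
with `w = |D| u` and `v = ∂ₜ u`. -/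
structure IsFourierSolution (b : ℝ → ℝ) (f g : L2 n) (w v : ℝ → L2 n)
    (Y Z : ℝ → EuclideanSpace ℝ (Fin n) → ℂ) : Prop where
  oscillator : ∀ ξ, IsComplexOscillator b (laplaceSymbol n ξ) (fun t => Y t ξ) (fun t => Z t ξ)
  fst_zero : ∀ ξ, (japaneseSymbol n ξ : ℂ) * Y 0 ξ = (𝓕 f : L2 n) ξ
  snd_zero : ∀ ξ, Z 0 ξ = Complex.I * (𝓕 g : L2 n) ξ
  absD : ∀ t, 0 ≤ t → ∀ᵐ ξ, (𝓕 (w t) : L2 n) ξ = (absSymbol n ξ : ℂ) * Y t ξ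
  deriv : ∀ t, 0 ≤ t → ∀ᵐ ξ, (𝓕 (v t) : L2 n) ξ = Z t ξ

theorem norm_sq_data {f g y z : ℂ} {ξ : EuclideanSpace ℝ (Fin n)}
    (hy : (japaneseSymbol n ξ : ℂ) * y = f) (hz : z = Complex.I * g) :
    (1 + laplaceSymbol n ξ) * ‖y‖ ^ 2 + ‖z‖ ^ 2 = ‖f‖ ^ 2 + ‖g‖ ^ 2 := by
  rw [← hy, hz, norm_mul, norm_mul, Complex.norm_I, one_mul, Complex.norm_real, mul_pow,
    Real.norm_eq_abs, sq_abs, japaneseSymbol_sq]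

/-- Solvability on the Fourier side, with bounds by the data. -/
theorem exists_fourierSide_solution {b : ℝ → ℝ} (hbc : Continuous b) (f g : L2 n) :
    ∃ Y Z : ℝ → EuclideanSpace ℝ (Fin n) → ℂ,
      (∀ ξ, IsComplexOscillator b (laplaceSymbol n ξ) (fun t => Y t ξ) (fun t => Z t ξ)) ∧
      (∀ ξ, (japaneseSymbol n ξ : ℂ) * Y 0 ξ = f ξ) ∧ (∀ ξ, Z 0 ξ = Complex.I * g ξ) ∧
      (∀ t, AEStronglyMeasurable (Y t) volume) ∧ (∀ t, AEStronglyMeasurable (Z t) volume) := by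
  -- The solution is the combination of the two fundamental solutions, evaluated at μ = |2πξ|², with
  -- coefficients f / ⟨2πξ⟩ and i g.
  obtain ⟨y₁, z₁, hy₁, hz₁, hy₁0, hz₁0, hy₁d, hz₁d⟩ := exists_dampedOscillator_solution hbc 1 0
  obtain ⟨y₂, z₂, hy₂, hz₂, hy₂0, hz₂0, hy₂d, hz₂d⟩ := exists_dampedOscillator_solution hbc 0 1
  have hmeas : ∀ {x₁ x₂ : ℝ → ℝ}, Measurable x₁ → Measurable x₂ →
      AEStronglyMeasurable (fun ξ => (x₁ (laplaceSymbol n ξ) : ℂ) *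
        ((japaneseSymbol n ξ : ℂ)⁻¹ * f ξ) + (x₂ (laplaceSymbol n ξ) : ℂ) * (Complex.I * g ξ))
        volume := by
    intro x₁ x₂ h₁ h₂
    have hl := (continuous_laplaceSymbol (n := n)).measurable
    have hj := (continuous_japaneseSymbol (n := n)).measurable
    have e1 : Measurable fun ξ : EuclideanSpace ℝ (Fin n) => (x₁ (laplaceSymbol n ξ) : ℂ) :=
      Complex.measurable_ofReal.comp (h₁.comp hl)
    have e2 : Measurable fun ξ : EuclideanSpace ℝ (Fin n) => (x₂ (laplaceSymbol n ξ) : ℂ) :=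
      Complex.measurable_ofReal.comp (h₂.comp hl)
    have e3 : Measurable fun ξ : EuclideanSpace ℝ (Fin n) => (japaneseSymbol n ξ : ℂ)⁻¹ :=
      (Complex.measurable_ofReal.comp hj).inv
    exact (e1.aestronglyMeasurable.mul
      (e3.aestronglyMeasurable.mul (Lp.aestronglyMeasurable f))).add
      (e2.aestronglyMeasurable.mul ((Lp.aestronglyMeasurable g).const_mul _))
  refine ⟨fun t ξ => (y₁ t (laplaceSymbol n ξ) : ℂ) * ((japaneseSymbol n ξ : ℂ)⁻¹ * f ξ) +
      (y₂ t (laplaceSymbol n ξ) : ℂ) * (Complex.I * g ξ),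
    fun t ξ => (z₁ t (laplaceSymbol n ξ) : ℂ) * ((japaneseSymbol n ξ : ℂ)⁻¹ * f ξ) +
      (z₂ t (laplaceSymbol n ξ) : ℂ) * (Complex.I * g ξ), fun ξ => ⟨fun t => ?_, fun t => ?_⟩,
    fun ξ => ?_, fun ξ => ?_, fun t => hmeas (hy₁ t) (hy₂ t), fun t => hmeas (hz₁ t) (hz₂ t)⟩
  · exact ((hy₁d _ t).ofReal_comp.mul_const _).add ((hy₂d _ t).ofReal_comp.mul_const _)
  · refine (((hz₁d _ t).ofReal_comp.mul_const _).add
      ((hz₂d _ t).ofReal_comp.mul_const _)).congr_deriv ?_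
    push_cast
    ring
  · have : (japaneseSymbol n ξ : ℂ) ≠ 0 :=
      Complex.ofReal_ne_zero.2 (japaneseSymbol_pos ξ).ne'
    simp only [hy₁0, hy₂0]
    field_simp
    simp
  · simp [hz₁0, hz₂0]

end Existence

/-! ### Construction of the energy solution in L² -/

section Construction

variable {n : ℕ}

theorem integrable_schwartz_mul (ψ : 𝓢(EuclideanSpace ℝ (Fin n), ℂ))
    {N : EuclideanSpace ℝ (Fin n) → ℝ} (hN : MemLp N 2 volume) :
    Integrable fun ξ => ‖ψ ξ‖ * N ξ :=
  (ψ.memLp 2 volume).norm.integrable_mul hN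

/-- The Cauchy problem is solvable, with an explicit solution on the Fourier side. -/
theorem exists_isFourierSolution {b b₁ : ℝ → ℝ} (hbc : Continuous b₁) (hpos : ∀ t, 0 < b₁ t)
    (hbb : ∀ t, 0 ≤ t → b t = b₁ t) (f g : L2 n) :
    ∃ (u w v : ℝ → L2 n) (Y Z : ℝ → EuclideanSpace ℝ (Fin n) → ℂ),
      SolvesCauchyProblem b f g u w v ∧ IsFourierSolution b₁ f g w v Y Z := by
  obtain ⟨Y, Z, hosc, hY0, hZ0, hYm, hZm⟩ :=
    exists_fourierSide_solution hbc (𝓕 f : L2 n) (𝓕 g : L2 n)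
  set N : EuclideanSpace ℝ (Fin n) → ℝ := fun ξ => ‖(𝓕 f : L2 n) ξ‖ + ‖(𝓕 g : L2 n) ξ‖ with hN
  have hNL : MemLp N 2 volume := (Lp.memLp (𝓕 f : L2 n)).norm.add (Lp.memLp (𝓕 g : L2 n)).norm
  have hN0 : ∀ ξ, 0 ≤ N ξ := fun ξ => by positivity
  have hdata : ∀ ξ, laplaceSymbol n ξ * ‖Y 0 ξ‖ ^ 2 + ‖Z 0 ξ‖ ^ 2 ≤ N ξ ^ 2 ∧
      ‖Y 0 ξ‖ ≤ N ξ := by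
    intro ξ
    have h1 := norm_sq_data (hY0 ξ) (hZ0 ξ)
    have h2 : ‖(𝓕 f : L2 n) ξ‖ ^ 2 + ‖(𝓕 g : L2 n) ξ‖ ^ 2 ≤ N ξ ^ 2 := by
      simp only [hN]
      nlinarith [mul_nonneg (norm_nonneg ((𝓕 f : L2 n) ξ)) (norm_nonneg ((𝓕 g : L2 n) ξ))]
    have h3 := mul_nonneg (laplaceSymbol_nonneg ξ) (sq_nonneg ‖Y 0 ξ‖)
    refine ⟨by nlinarith [sq_nonneg ‖Y 0 ξ‖],
      (le_abs_self _).trans (abs_le_of_sq_le_sq ?_ (hN0 ξ))⟩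
    nlinarith [sq_nonneg ‖Z 0 ξ‖]
  have hen : ∀ t, 0 ≤ t → ∀ ξ, ‖(absSymbol n ξ : ℂ) * Y t ξ‖ ≤ N ξ ∧ ‖Z t ξ‖ ≤ N ξ := by
    intro t ht ξ
    have h1 := ((hosc ξ).energy_le hpos ht).trans (hdata ξ).1
    have h2 := mul_nonneg (laplaceSymbol_nonneg ξ) (sq_nonneg ‖Y t ξ‖)
    constructor
    · refine (le_abs_self _).trans (abs_le_of_sq_le_sq ?_ (hN0 ξ))
      rw [norm_mul, Complex.norm_real, mul_pow, Real.norm_eq_abs, sq_abs, ← laplaceSymbol_eq_sq]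
      nlinarith [sq_nonneg ‖Z t ξ‖]
    · refine (le_abs_self _).trans (abs_le_of_sq_le_sq ?_ (hN0 ξ))
      nlinarith
  -- The energy does not control Y near ξ = 0, so Y is recovered by integrating its time derivative.
  have hYb : ∀ t, 0 ≤ t → ∀ ξ, ‖Y t ξ‖ ≤ (1 + t) * N ξ := by
    intro t ht ξ
    have h := (convex_Icc (0 : ℝ) t).norm_image_sub_le_of_norm_hasDerivWithin_le
      (f := fun r => Y r ξ) (f' := fun r => Z r ξ) (C := N ξ)
      (fun r _ => ((hosc ξ).hasDerivAt_fst r).hasDerivWithinAt) (fun r hr => (hen r hr.1 ξ).2)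
      (left_mem_Icc.2 ht) (right_mem_Icc.2 ht)
    rw [sub_zero, Real.norm_eq_abs, abs_of_nonneg ht] at h
    have h2 := norm_le_insert' (Y t ξ) (Y 0 ξ)
    have h3 := (hdata ξ).2
    linarith
  have hXm : ∀ t, AEStronglyMeasurable (fun ξ => (absSymbol n ξ : ℂ) * Y t ξ) volume := fun t =>
    (Complex.continuous_ofReal.comp continuous_absSymbol).aestronglyMeasurable.mul (hYm t)
  -- The energy bounds hold only for t ≥ 0; freezing time at 0 before that makes the L² curves total
  -- functions.
  have hYL : ∀ t, MemLp (Y (max t 0)) 2 volume := fun t =>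
    MemLp.of_le_mul (c := 1 + max t 0) hNL (hYm _) (Eventually.of_forall fun ξ => by
      rw [Real.norm_of_nonneg (hN0 ξ)]; exact hYb _ (le_max_right _ _) ξ)
  have hXL : ∀ t, MemLp (fun ξ => (absSymbol n ξ : ℂ) * Y (max t 0) ξ) 2 volume := fun t =>
    MemLp.of_le hNL (hXm _) (Eventually.of_forall fun ξ => by
      rw [Real.norm_of_nonneg (hN0 ξ)]; exact (hen _ (le_max_right _ _) ξ).1)
  have hZL : ∀ t, MemLp (Z (max t 0)) 2 volume := fun t =>
    MemLp.of_le hNL (hZm _) (Eventually.of_forall fun ξ => by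
      rw [Real.norm_of_nonneg (hN0 ξ)]; exact (hen _ (le_max_right _ _) ξ).2)
  have hN2 : MemLp (fun ξ => 2 * N ξ) 2 volume := hNL.const_mul 2
  have hYcont : ∀ ξ, Continuous fun t => Y t ξ := fun ξ =>
    continuous_iff_continuousAt.2 fun t => ((hosc ξ).hasDerivAt_fst t).continuousAt
  have hZcont : ∀ ξ, Continuous fun t => Z t ξ := fun ξ =>
    continuous_iff_continuousAt.2 fun t => ((hosc ξ).hasDerivAt_snd t).continuousAt
  set U : ℝ → L2 n := fun t => (hYL t).toLp _ with hU
  set X : ℝ → L2 n := fun t => (hXL t).toLp _ with hX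
  set V : ℝ → L2 n := fun t => (hZL t).toLp _ with hV
  have hXc : Continuous X := continuous_iff_continuousAt.2 fun t => by
    refine tendsto_toLp_two_of_dominated hXL (hXL t) hN2 (Eventually.of_forall fun s =>
      Eventually.of_forall fun ξ => ?_) (Eventually.of_forall fun ξ => ?_)
    · refine (norm_sub_le _ _).trans ?_
      linarith [(hen _ (le_max_right s 0) ξ).1, (hen _ (le_max_right t 0) ξ).1]
    · have hc : Continuous fun s => (absSymbol n ξ : ℂ) * Y (max s 0) ξ :=
        continuous_const.mul ((hYcont ξ).comp (by fun_prop))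
      exact hc.tendsto t
  have hVc : Continuous V := continuous_iff_continuousAt.2 fun t => by
    refine tendsto_toLp_two_of_dominated hZL (hZL t) hN2 (Eventually.of_forall fun s =>
      Eventually.of_forall fun ξ => ?_) (Eventually.of_forall fun ξ => ?_)
    · refine (norm_sub_le _ _).trans ?_
      linarith [(hen _ (le_max_right s 0) ξ).2, (hen _ (le_max_right t 0) ξ).2]
    · have hc : Continuous fun s => Z (max s 0) ξ := (hZcont ξ).comp (by fun_prop)
      exact hc.tendsto t
  have hUp : ∀ (ψ : 𝓢(EuclideanSpace ℝ (Fin n), ℂ)) t, 0 ≤ t →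
      (U t : 𝓢'(EuclideanSpace ℝ (Fin n), ℂ)) ψ = ∫ ξ, ψ ξ * Y t ξ := fun ψ t ht => by
    rw [Lp.toTemperedDistribution_apply]
    refine integral_congr_ae ?_
    filter_upwards [(hYL t).coeFn_toLp] with ξ h
    rw [smul_eq_mul, h, max_eq_left ht]
  have hVp : ∀ (ψ : 𝓢(EuclideanSpace ℝ (Fin n), ℂ)) t, 0 ≤ t →
      (V t : 𝓢'(EuclideanSpace ℝ (Fin n), ℂ)) ψ = ∫ ξ, ψ ξ * Z t ξ := fun ψ t ht => by
    rw [Lp.toTemperedDistribution_apply]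
    refine integral_congr_ae ?_
    filter_upwards [(hZL t).coeFn_toLp] with ξ h
    rw [smul_eq_mul, h, max_eq_left ht]
  have hYi : ∀ (ψ : 𝓢(EuclideanSpace ℝ (Fin n), ℂ)) t, 0 ≤ t →
      Integrable (fun ξ => ψ ξ * Y t ξ) volume := fun ψ t ht => by
    have := hYL t
    rw [max_eq_left ht] at this
    exact (ψ.memLp 2 volume).integrable_mul this
  have hZi : ∀ (ψ : 𝓢(EuclideanSpace ℝ (Fin n), ℂ)) t, 0 ≤ t →
      Integrable (fun ξ => ψ ξ * Z t ξ) volume := fun ψ t ht => by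
    have := hZL t
    rw [max_eq_left ht] at this
    exact (ψ.memLp 2 volume).integrable_mul this
  have hUd : ∀ t, 0 ≤ t → HasDerivWithinAt U (V t) (Ici 0) t := by
    intro t ht
    refine hasDerivWithinAt_of_weak hVc.continuousOn (fun ψ s hs => ?_) ht
    rw [hVp ψ s hs]
    refine (hasDerivWithinAt_integral_Ici (A := fun r ξ => ψ ξ * Y r ξ)
      (A' := fun r ξ => ψ ξ * Z r ξ) (g := fun ξ => ‖ψ ξ‖ * N ξ) hs (hYi ψ)
      (fun ξ r _ => ((hosc ξ).hasDerivAt_fst r).const_mul _) (fun r hr _ ξ => ?_)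
      (integrable_schwartz_mul ψ hNL)).congr (fun r hr => hUp ψ r hr) (hUp ψ s hs)
    rw [norm_mul]
    exact mul_le_mul_of_nonneg_left (hen r hr ξ).2 (norm_nonneg _)
  have hVd : ∀ (ψ : 𝓢(EuclideanSpace ℝ (Fin n), ℂ)) t, 0 ≤ t →
      HasDerivWithinAt (fun s => (V s : 𝓢'(EuclideanSpace ℝ (Fin n), ℂ)) ψ)
        (-(U t : 𝓢'(EuclideanSpace ℝ (Fin n), ℂ))
            (SchwartzMap.smulLeftCLM ℂ (fun ξ => (laplaceSymbol n ξ : ℂ)) ψ)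
          - (b t : ℂ) * (V t : 𝓢'(EuclideanSpace ℝ (Fin n), ℂ)) ψ) (Ici 0) t := by
    intro ψ t ht
    set ψ₂ := SchwartzMap.smulLeftCLM ℂ (fun ξ => (laplaceSymbol n ξ : ℂ)) ψ
    have hψ₂ : ∀ ξ, ψ₂ ξ = (laplaceSymbol n ξ : ℂ) * ψ ξ := fun ξ =>
      SchwartzMap.smulLeftCLM_apply_apply hasTemperateGrowth_laplaceSymbol ψ ξ
    obtain ⟨B, hB⟩ := (isCompact_Icc (a := (0 : ℝ)) (b := t + 1)).exists_bound_of_continuousOn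
      hbc.continuousOn
    have hval : -(U t : 𝓢'(EuclideanSpace ℝ (Fin n), ℂ)) ψ₂
          - (b t : ℂ) * (V t : 𝓢'(EuclideanSpace ℝ (Fin n), ℂ)) ψ =
        ∫ ξ, ψ ξ * (-((b₁ t : ℂ) * Z t ξ) - (laplaceSymbol n ξ : ℂ) * Y t ξ) := by
      rw [hUp ψ₂ t ht, hVp ψ t ht, hbb t ht, ← integral_const_mul, ← integral_neg]
      refine (integral_sub (hYi ψ₂ t ht).neg ((hZi ψ t ht).const_mul _)).symm.trans ?_
      refine integral_congr_ae (Eventually.of_forall fun ξ => ?_)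
      simp only [hψ₂, Pi.neg_apply]
      ring
    rw [hval]
    refine (hasDerivWithinAt_integral_Ici (A := fun r ξ => ψ ξ * Z r ξ)
      (A' := fun r ξ => ψ ξ * (-((b₁ r : ℂ) * Z r ξ) - (laplaceSymbol n ξ : ℂ) * Y r ξ))
      (g := fun ξ => (B + 1) * (‖ψ ξ‖ * N ξ) + ‖ψ₂ ξ‖ * N ξ) ht (hZi ψ)
      (fun ξ r _ => ((hosc ξ).hasDerivAt_snd r).const_mul _) (fun r hr hr' ξ => ?_)
      (((integrable_schwartz_mul ψ hNL).const_mul _).add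
        (integrable_schwartz_mul ψ₂ hNL))).congr (fun r hr => hVp ψ r hr) (hVp ψ t ht)
    have hBr : |b₁ r| ≤ B := hB r ⟨hr, hr'⟩
    obtain ⟨hx, hz⟩ := hen r hr ξ
    rw [norm_mul, Complex.norm_real, Real.norm_eq_abs, abs_of_nonneg (absSymbol_nonneg ξ)] at hx
    have ha := absSymbol_nonneg ξ
    rw [hψ₂, norm_mul, norm_mul, Complex.norm_real, Real.norm_eq_abs,
      abs_of_nonneg (laplaceSymbol_nonneg ξ)]
    have h1 : ‖-((b₁ r : ℂ) * Z r ξ) - (laplaceSymbol n ξ : ℂ) * Y r ξ‖ ≤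
        B * N ξ + absSymbol n ξ * N ξ := by
      refine (norm_sub_le _ _).trans (add_le_add ?_ ?_)
      · rw [norm_neg, norm_mul, Complex.norm_real, Real.norm_eq_abs]
        exact mul_le_mul hBr hz (norm_nonneg _) ((abs_nonneg _).trans hBr)
      · rw [norm_mul, Complex.norm_real, Real.norm_eq_abs,
          abs_of_nonneg (laplaceSymbol_nonneg ξ), laplaceSymbol_eq_sq, sq, mul_assoc]
        exact mul_le_mul_of_nonneg_left hx ha
    -- The norm |2πξ| is not smooth at 0; this polynomial bound lets the Schwartz functions ψ and ψ₂
    -- absorb the growth.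
    have h2 : absSymbol n ξ ≤ 1 + laplaceSymbol n ξ := by
      rw [laplaceSymbol_eq_sq]; nlinarith [sq_nonneg (absSymbol n ξ - 1)]
    have h3 : absSymbol n ξ * N ξ ≤ (1 + laplaceSymbol n ξ) * N ξ :=
      mul_le_mul_of_nonneg_right h2 (hN0 ξ)
    calc ‖ψ ξ‖ * _ ≤ ‖ψ ξ‖ * (B * N ξ + (1 + laplaceSymbol n ξ) * N ξ) :=
          mul_le_mul_of_nonneg_left (h1.trans (add_le_add_right h3 _)) (norm_nonneg _)
      _ = _ := by ring
  have hinv : Continuous fun x : L2 n => (𝓕⁻ x : L2 n) :=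
    (Lp.fourierTransformₗᵢ (EuclideanSpace ℝ (Fin n)) ℂ).symm.continuous
  have hFF : ∀ x : L2 n, (𝓕 (𝓕⁻ x : L2 n) : L2 n) = x := fun x =>
    FourierTransform.fourier_fourierInv_eq x
  refine ⟨fun t => 𝓕⁻ (U t), fun t => 𝓕⁻ (X t), fun t => 𝓕⁻ (V t), Y, Z,
    ⟨⟨fun t ht => ?_, (hinv.comp hXc).continuousOn, fun t ht => ?_, (hinv.comp hVc).continuousOn,
      fun φ t ht => ?_⟩, ?_, ?_⟩, ⟨hosc, hY0, hZ0, fun t ht => ?_, fun t ht => ?_⟩⟩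
  · unfold IsFourierMultiplier
    rw [hFF, hFF]
    filter_upwards [(hXL t).coeFn_toLp, (hYL t).coeFn_toLp] with ξ h1 h2
    rw [h1, h2]
  · exact (((Lp.fourierTransformₗᵢ (EuclideanSpace ℝ (Fin n)) ℂ).symm.toContinuousLinearEquiv
      : L2 n →L[ℂ] L2 n).restrictScalars ℝ).hasFDerivAt.comp_hasDerivWithinAt t (hUd t ht)
  · obtain ⟨ψ, rfl⟩ : ∃ ψ : 𝓢(EuclideanSpace ℝ (Fin n), ℂ), 𝓕 ψ = φ :=
      ⟨𝓕⁻ φ, FourierTransform.fourier_fourierInv_eq φ⟩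
    have hV' : ∀ s, ((𝓕⁻ (V s) : L2 n) : 𝓢'(EuclideanSpace ℝ (Fin n), ℂ)) (𝓕 ψ) =
        (V s : 𝓢'(EuclideanSpace ℝ (Fin n), ℂ)) ψ := fun s => by
      rw [toTemperedDistribution_fourier, hFF]
    rw [laplacian_fourier_apply, hFF, hV']
    exact (hVd ψ t ht).congr (fun s _ => hV' s) (hV' t)
  · unfold IsFourierMultiplier
    rw [hFF]
    filter_upwards [(hYL 0).coeFn_toLp] with ξ h1
    rw [h1, max_self, hY0]
  · have : V 0 = Complex.I • (𝓕 g : L2 n) := by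
      refine Lp.ext ?_
      filter_upwards [(hZL 0).coeFn_toLp, Lp.coeFn_smul Complex.I (𝓕 g : L2 n)] with ξ h1 h2
      rw [h1, h2, max_self, hZ0, Pi.smul_apply, smul_eq_mul]
    change -Complex.I • (𝓕⁻ (V 0) : L2 n) = g
    rw [this, FourierTransform.fourierInv_smul, FourierTransform.fourierInv_fourier_eq, smul_smul,
      neg_mul, Complex.I_mul_I, neg_neg, one_smul]
  · rw [hFF]
    filter_upwards [(hXL t).coeFn_toLp] with ξ h1
    rw [h1, max_eq_left ht]
  · rw [hFF]
    filter_upwards [(hZL t).coeFn_toLp] with ξ h1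
    rw [h1, max_eq_left ht]

end Construction

/-! ### The damping coefficient -/

/-- The coefficient of the theorem, extended constantly to `t < 0`, is an effective damping. -/
theorem exists_isEffectiveDamping {b : ℝ → ℝ} (hsmooth : ContDiffOn ℝ ∞ b (Ici 0))
    (hnn : ∀ t, 0 ≤ t → 0 ≤ b t)
    (hder : ∃ C : ℝ, ∀ t, 0 ≤ t →
      |iteratedDerivWithin 1 b (Ici 0) t| ≤ C * b t * (1 / (1 + t)) ^ 1)
    (hE : Tendsto (fun t => t * b t) atTop atTop) :
    ∃ (b' : ℝ → ℝ) (C : ℝ), IsEffectiveDamping (fun t => b (max t 0)) b' C := by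
  obtain ⟨C, hC⟩ := hder
  simp only [iteratedDerivWithin_one, pow_one] at hC
  have hd : ∀ t, 0 ≤ t → HasDerivWithinAt b (derivWithin b (Ici 0) t) (Ici 0) t := fun t ht =>
    (hsmooth.differentiableOn (by simp) t ht).hasDerivWithinAt
  have hpos : ∀ t, 0 ≤ t → 0 < b t := by
    intro t₀ ht₀
    -- By Gronwall with |b'| ≤ |C| b, a zero of b would persist for all later times, contradicting t
    -- b → ∞.
    refine lt_of_le_of_ne (hnn t₀ ht₀) fun h0 => ?_
    have hz : ∀ T, t₀ ≤ T → b T = 0 := fun T hT =>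
      eq_zero_of_abs_deriv_le_mul_abs_self_of_eq_zero_right (f := b) (K := |C|)
        (f' := derivWithin b (Ici 0))
        (hsmooth.continuousOn.mono fun x hx => mem_Ici.2 (ht₀.trans hx.1))
        (fun x hx => (hd x (ht₀.trans hx.1)).mono (Ici_subset_Ici.2 (ht₀.trans hx.1))) h0.symm
        (fun x hx => by
          have hx0 := ht₀.trans hx.1
          have hb0 := hnn x hx0
          have h1 : 1 / (1 + x) ≤ 1 := by rw [div_le_one (by linarith)]; linarith
          have h2 : 0 ≤ 1 / (1 + x) := by positivity
          rw [Real.norm_eq_abs, Real.norm_eq_abs, abs_of_nonneg hb0]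
          refine (hC x hx0).trans ?_
          calc C * b x * (1 / (1 + x)) ≤ |C| * b x * (1 / (1 + x)) := by
                gcongr; exact le_abs_self C
            _ ≤ |C| * b x * 1 := by gcongr
            _ = |C| * b x := mul_one _) T (right_mem_Icc.2 hT)
    obtain ⟨T, hT⟩ := ((hE.eventually_gt_atTop 0).and (eventually_ge_atTop t₀)).exists
    rw [hz T hT.2, mul_zero] at hT
    exact lt_irrefl _ hT.1
  refine ⟨derivWithin b (Ici 0), C, ?_, fun t => hpos _ (le_max_right _ _), fun t ht => ?_,
    fun t ht => ?_, ?_⟩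
  · exact hsmooth.continuousOn.comp_continuous (by fun_prop) fun t => mem_Ici.2 (le_max_right _ _)
  · refine ((hd t ht.le).hasDerivAt (Ici_mem_nhds ht)).congr_of_eventuallyEq ?_
    filter_upwards [Ioi_mem_nhds ht] with s hs
    rw [max_eq_left (le_of_lt hs)]
  · simp only [max_eq_left ht.le]
    exact (hC t ht.le).trans (le_of_eq (by ring))
  · refine hE.congr' ?_
    filter_upwards [eventually_ge_atTop 0] with s hs
    rw [max_eq_left hs]

theorem invIntegral_max {b : ℝ → ℝ} {t : ℝ} (ht : 0 ≤ t) :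
    invIntegral (fun s => b (max s 0)) t = ∫ τ in (0 : ℝ)..t, 1 / b τ := by
  refine intervalIntegral.integral_congr fun s hs => ?_
  rw [uIcc_of_le ht] at hs
  simp only [max_eq_left hs.1]

/-- A monotone primitive either diverges or converges; as 1/b is positive, convergence would make it
integrable. -/
theorem IsEffectiveDamping.tendsto_invIntegral {b b' : ℝ → ℝ} {C : ℝ}
    (hb : IsEffectiveDamping b b' C) (hL1 : ¬ IntegrableOn (fun t => 1 / b t) (Ici 0)) :
    Tendsto (invIntegral b) atTop atTop := by
  have hmono : Monotone (invIntegral b) :=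
    monotone_of_deriv_nonneg (fun t => (hb.hasDerivAt_invIntegral t).differentiableAt) fun t => by
      rw [(hb.hasDerivAt_invIntegral t).deriv]
      exact (one_div_pos.2 (hb.pos t)).le
  have hc : Continuous fun t => 1 / b t :=
    continuous_const.div hb.continuous fun t => (hb.pos t).ne'
  rcases tendsto_atTop_of_monotone hmono with h | ⟨l, hl⟩
  · exact h
  · refine absurd ?_ hL1
    rw [integrableOn_Ici_iff_integrableOn_Ioi]
    refine integrableOn_Ioi_of_intervalIntegral_norm_tendsto l 0 (b := fun t : ℝ => t)
      (fun t => (hc.integrableOn_Icc).mono_set Ioc_subset_Icc_self) tendsto_id ?_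
    refine hl.congr fun t => ?_
    refine intervalIntegral.integral_congr fun s _ => ?_
    exact (Real.norm_of_nonneg (one_div_pos.2 (hb.pos s)).le).symm

/-! ### The energy operator -/

section EnergyOperator

variable {n : ℕ}

theorem energySpace_norm_sq (f g : L2 n) :
    ‖(WithLp.toLp 2 (f, g) : EnergySpace n)‖ ^ 2 = ‖f‖ ^ 2 + ‖g‖ ^ 2 := by
  rw [WithLp.prod_norm_sq_eq_of_L2]
  rfl

/-- The pair `(|D| u, D_t u)`. -/
noncomputable def energyPair (w v : ℝ → L2 n) (t : ℝ) : EnergySpace n :=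
  WithLp.toLp 2 (w t, (-Complex.I) • v t)

namespace IsFourierSolution

theorem energy_integral {b : ℝ → ℝ} {f g : L2 n} {w v : ℝ → L2 n}
    {Y Z : ℝ → EuclideanSpace ℝ (Fin n) → ℂ} (h : IsFourierSolution b f g w v Y Z) {t : ℝ}
    (ht : 0 ≤ t) :
    Integrable (fun ξ => laplaceSymbol n ξ * ‖Y t ξ‖ ^ 2 + ‖Z t ξ‖ ^ 2) ∧
      ‖energyPair w v t‖ ^ 2 = ∫ ξ, laplaceSymbol n ξ * ‖Y t ξ‖ ^ 2 + ‖Z t ξ‖ ^ 2 := by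
  have e : (fun ξ => laplaceSymbol n ξ * ‖Y t ξ‖ ^ 2 + ‖Z t ξ‖ ^ 2) =ᵐ[volume]
      fun ξ => ‖(𝓕 (w t) : L2 n) ξ‖ ^ 2 + ‖(𝓕 (v t) : L2 n) ξ‖ ^ 2 := by
    filter_upwards [h.absD t ht, h.deriv t ht] with ξ h1 h2
    rw [h1, h2, norm_mul, Complex.norm_real, mul_pow, Real.norm_eq_abs, sq_abs,
      ← laplaceSymbol_eq_sq]
  have i1 := L2_integrable_norm_sq (𝓕 (w t) : L2 n)
  have i2 := L2_integrable_norm_sq (𝓕 (v t) : L2 n)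
  refine ⟨(i1.add i2).congr e.symm, ?_⟩
  rw [energyPair, energySpace_norm_sq, norm_smul, norm_neg, Complex.norm_I, one_mul,
    integral_congr_ae e, integral_add i1 i2, ← L2_norm_sq_eq_integral, ← L2_norm_sq_eq_integral,
    Lp.norm_fourier_eq, Lp.norm_fourier_eq]

theorem data_integral {b : ℝ → ℝ} {f g : L2 n} {w v : ℝ → L2 n}
    {Y Z : ℝ → EuclideanSpace ℝ (Fin n) → ℂ} (h : IsFourierSolution b f g w v Y Z) :
    Integrable (fun ξ => (1 + laplaceSymbol n ξ) * ‖Y 0 ξ‖ ^ 2 + ‖Z 0 ξ‖ ^ 2) ∧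
      ‖(WithLp.toLp 2 (f, g) : EnergySpace n)‖ ^ 2 =
        ∫ ξ, (1 + laplaceSymbol n ξ) * ‖Y 0 ξ‖ ^ 2 + ‖Z 0 ξ‖ ^ 2 := by
  have e : (fun ξ => (1 + laplaceSymbol n ξ) * ‖Y 0 ξ‖ ^ 2 + ‖Z 0 ξ‖ ^ 2) =
      fun ξ => ‖(𝓕 f : L2 n) ξ‖ ^ 2 + ‖(𝓕 g : L2 n) ξ‖ ^ 2 :=
    funext fun ξ => norm_sq_data (h.fst_zero ξ) (h.snd_zero ξ)
  have i1 := L2_integrable_norm_sq (𝓕 f : L2 n)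
  have i2 := L2_integrable_norm_sq (𝓕 g : L2 n)
  rw [e]
  refine ⟨i1.add i2, ?_⟩
  rw [energySpace_norm_sq, integral_add i1 i2, ← L2_norm_sq_eq_integral,
    ← L2_norm_sq_eq_integral, Lp.norm_fourier_eq, Lp.norm_fourier_eq]

theorem norm_energyPair_le {b : ℝ → ℝ} (hpos : ∀ t, 0 < b t) {f g : L2 n} {w v : ℝ → L2 n}
    {Y Z : ℝ → EuclideanSpace ℝ (Fin n) → ℂ} (h : IsFourierSolution b f g w v Y Z) {t : ℝ}
    (ht : 0 ≤ t) : ‖energyPair w v t‖ ≤ ‖(WithLp.toLp 2 (f, g) : EnergySpace n)‖ := by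
  refine (le_abs_self _).trans (abs_le_of_sq_le_sq ?_ (norm_nonneg _))
  rw [(h.energy_integral ht).2, h.data_integral.2]
  refine integral_mono (h.energy_integral ht).1 h.data_integral.1 fun ξ => ?_
  have := (h.oscillator ξ).energy_le hpos ht
  simp only
  nlinarith [sq_nonneg ‖Y 0 ξ‖]

theorem weighted_norm_energyPair_le {b : ℝ → ℝ} {f g : L2 n} {w v : ℝ → L2 n}
    {Y Z : ℝ → EuclideanSpace ℝ (Fin n) → ℂ} (h : IsFourierSolution b f g w v Y Z)
    {η W : ℝ → ℝ} (hw : IsDecayWeight b η W) {t : ℝ} (ht : 0 ≤ t) :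
    W t * ‖energyPair w v t‖ ^ 2 ≤
      4 * (W 0 + η 0 + 1) * ‖(WithLp.toLp 2 (f, g) : EnergySpace n)‖ ^ 2 := by
  rw [(h.energy_integral ht).2, h.data_integral.2, ← integral_const_mul, ← integral_const_mul]
  exact integral_mono ((h.energy_integral ht).1.const_mul _) (h.data_integral.1.const_mul _)
    fun ξ => (h.oscillator ξ).weighted_energy_le (laplaceSymbol_nonneg ξ) hw ht

/-- Dominated convergence in ξ: the uniform weighted estimate supplies a multiple of the data
density as majorant. -/
theorem tendsto_weighted_norm_energyPair {b : ℝ → ℝ} (hpos : ∀ t, 0 < b t) {f g : L2 n}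
    {w v : ℝ → L2 n} {Y Z : ℝ → EuclideanSpace ℝ (Fin n) → ℂ}
    (h : IsFourierSolution b f g w v Y Z) {η W : ℝ → ℝ} (hw : IsDecayWeight b η W)
    (hW : Tendsto W atTop atTop) :
    Tendsto (fun t => W t * ‖energyPair w v t‖ ^ 2) atTop (𝓝 0) := by
  have hlim : Tendsto
      (fun t => ∫ ξ, W t * (laplaceSymbol n ξ * ‖Y t ξ‖ ^ 2 + ‖Z t ξ‖ ^ 2)) atTop
      (𝓝 (∫ _ : EuclideanSpace ℝ (Fin n), (0 : ℝ))) := by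
    refine tendsto_integral_filter_of_dominated_convergence
      (fun ξ => 4 * (W 0 + η 0 + 1) * ((1 + laplaceSymbol n ξ) * ‖Y 0 ξ‖ ^ 2 + ‖Z 0 ξ‖ ^ 2))
      ?_ ?_ (h.data_integral.1.const_mul _) (Eventually.of_forall fun ξ =>
        (h.oscillator ξ).tendsto_weighted_energy hpos (laplaceSymbol_nonneg ξ) hw hW)
    · filter_upwards [eventually_ge_atTop 0] with t ht
      exact (h.energy_integral ht).1.1.const_mul _
    · filter_upwards [eventually_ge_atTop 0] with t ht
      refine Eventually.of_forall fun ξ => ?_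
      rw [Real.norm_of_nonneg (mul_nonneg (zero_le_one.trans (hw.one_le t ht))
        (add_nonneg (mul_nonneg (laplaceSymbol_nonneg ξ) (sq_nonneg _)) (sq_nonneg _)))]
      exact (h.oscillator ξ).weighted_energy_le (laplaceSymbol_nonneg ξ) hw ht
  rw [integral_zero] at hlim
  refine hlim.congr' ?_
  filter_upwards [eventually_ge_atTop 0] with t ht
  rw [(h.energy_integral ht).2, integral_const_mul]

end IsFourierSolution

/-- A solution is chosen for each datum; uniqueness of the energy makes the resulting map linear,
and dissipation bounds it by 1. -/
theorem energyOperator_spec {b b₁ : ℝ → ℝ} (hbc : Continuous b₁) (hpos : ∀ t, 0 < b₁ t)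
    (hbb : ∀ t, 0 ≤ t → b t = b₁ t) {t : ℝ} (ht : 0 ≤ t) :
    IsEnergyOperatorAt b t (energyOperator n b t) := by
  have hbc' : ContinuousOn b (Ici 0) := hbc.continuousOn.congr fun t ht => hbb t ht
  have hbnn : ∀ t, 0 ≤ t → 0 ≤ b t := fun t ht => by rw [hbb t ht]; exact (hpos t).le
  suffices h : ∃ T : EnergySpace n →L[ℂ] EnergySpace n, IsEnergyOperatorAt b t T by
    rw [energyOperator, dif_pos h]
    exact h.choose_spec
  choose u w v Y Z hsol hF using fun U : EnergySpace n =>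
    exists_isFourierSolution hbc hpos hbb U.fst U.snd
  have huniq : ∀ {f g : L2 n} {u' w' v' : ℝ → L2 n}, SolvesCauchyProblem b f g u' w' v' →
      energyPair (w (WithLp.toLp 2 (f, g))) (v (WithLp.toLp 2 (f, g))) t = energyPair w' v' t := by
    intro f g u' w' v' h'
    have := (hsol (WithLp.toLp 2 (f, g))).unique hbc' hbnn h' ht
    rw [energyPair, energyPair, this.1, this.2]
  let T : EnergySpace n →ₗ[ℂ] EnergySpace n :=
    { toFun := fun U => energyPair (w U) (v U) t
      map_add' := fun U U' => by
        refine (huniq ((hsol U).add (hsol U'))).trans ?_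
        simp only [energyPair, smul_add]
        rfl
      map_smul' := fun c U => by
        refine (huniq ((hsol U).const_smul c)).trans ?_
        simp only [energyPair, RingHom.id_apply]
        rw [smul_comm]
        rfl }
  refine ⟨T.mkContinuous 1 fun U => ?_, fun f g => ⟨⟨_, _, _, hsol (WithLp.toLp 2 (f, g))⟩,
    fun u' w' v' h' => huniq h'⟩⟩
  rw [one_mul]
  exact (hF U).norm_energyPair_le hpos ht

/-- The energy operator evaluated through the Fourier representation of the solution. -/
theorem exists_energyOperator_apply {b b₁ : ℝ → ℝ} (hbc : Continuous b₁) (hpos : ∀ t, 0 < b₁ t)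
    (hbb : ∀ t, 0 ≤ t → b t = b₁ t) (f g : L2 n) :
    ∃ (w v : ℝ → L2 n) (Y Z : ℝ → EuclideanSpace ℝ (Fin n) → ℂ),
      IsFourierSolution b₁ f g w v Y Z ∧
      ∀ t, 0 ≤ t → energyOperator n b t (WithLp.toLp 2 (f, g)) = energyPair w v t := by
  obtain ⟨u, w, v, Y, Z, hs, hF⟩ := exists_isFourierSolution hbc hpos hbb f g
  exact ⟨w, v, Y, Z, hF, fun t ht => (energyOperator_spec hbc hpos hbb ht f g).2 u w v hs⟩

/-- There are data concentrated at low frequencies whose energy decays no faster than `1 / W`. -/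
theorem exists_weighted_norm_energyOperator_ge (hn : 1 ≤ n) {b b₁ : ℝ → ℝ} (hbc : Continuous b₁)
    (hpos : ∀ t, 0 < b₁ t) (hbb : ∀ t, 0 ≤ t → b t = b₁ t) {η W : ℝ → ℝ}
    (hw : IsDecayWeight b₁ η W) :
    ∃ c, 0 < c ∧ ∀ t, 0 ≤ t → c ≤ W t * ‖energyOperator n b t‖ ^ 2 := by
  obtain ⟨κ, hκ, hκ1, hlow⟩ := IsDampedOscillator.exists_weighted_energy_ge hw
  refine ⟨κ / 64, by positivity, fun t ht => ?_⟩
  have hWt := hw.one_le t ht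
  have hW0 : 0 < W t := by linarith
  have hπ := Real.pi_pos
  -- The shell of frequencies of size W(t)^(-1/2), depending on t. Being open and nonempty, it has
  -- positive measure.
  set S : Set (EuclideanSpace ℝ (Fin n)) :=
    {ξ | κ / 2 < W t * laplaceSymbol n ξ ∧ W t * laplaceSymbol n ξ < κ} with hS
  have hlc : Continuous fun ξ => W t * laplaceSymbol n ξ :=
    continuous_const.mul continuous_laplaceSymbol
  have hSo : IsOpen S := (isOpen_lt continuous_const hlc).inter (isOpen_lt hlc continuous_const)
  have hSne : S.Nonempty := by
    have : Nonempty (Fin n) := ⟨⟨0, hn⟩⟩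
    set r := Real.sqrt (3 / 4 * κ / W t) / (2 * Real.pi) with hr
    obtain ⟨ξ, hξ⟩ := exists_norm_eq (EuclideanSpace ℝ (Fin n)) (c := r) (by positivity)
    have : W t * laplaceSymbol n ξ = 3 / 4 * κ := by
      rw [laplaceSymbol, hξ, hr, mul_div_cancel₀ _ (by positivity), Real.sq_sqrt (by positivity)]
      field_simp
    refine ⟨ξ, ?_, ?_⟩ <;> rw [this] <;> linarith
  have hμ1 : ∀ ξ ∈ S, laplaceSymbol n ξ ≤ 1 := fun ξ hξ => by
    have := laplaceSymbol_nonneg ξ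
    nlinarith [hξ.2]
  have hSfin : volume S ≠ ⊤ := by
    refine ne_top_of_le_ne_top (measure_closedBall_lt_top (x := (0 : EuclideanSpace ℝ (Fin n)))
      (r := 1)).ne (measure_mono fun ξ hξ => ?_)
    rw [mem_closedBall_zero_iff]
    have h1 := hμ1 ξ hξ
    rw [laplaceSymbol, sq_le_one_iff₀ (by positivity)] at h1
    nlinarith [Real.pi_gt_three, norm_nonneg ξ]
  have hjb : ∀ ξ ∈ S, japaneseSymbol n ξ ≤ 2 := fun ξ hξ => by
    refine (le_abs_self _).trans (abs_le_of_sq_le_sq ?_ (by norm_num))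
    rw [japaneseSymbol_sq]
    linarith [hμ1 ξ hξ]
  have hF : MemLp (S.indicator fun ξ => (japaneseSymbol n ξ : ℂ)) 2 volume := by
    refine MemLp.of_le_mul (c := 2) (memLp_indicator_const 2 hSo.measurableSet (1 : ℂ)
      (Or.inr hSfin)) ?_ (Eventually.of_forall fun ξ => ?_)
    · exact (Complex.continuous_ofReal.comp
        continuous_japaneseSymbol).aestronglyMeasurable.indicator hSo.measurableSet
    · by_cases hξ : ξ ∈ S
      · rw [indicator_of_mem hξ, indicator_of_mem hξ, norm_one, mul_one, Complex.norm_real,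
          Real.norm_of_nonneg (japaneseSymbol_pos ξ).le]
        exact hjb ξ hξ
      · rw [indicator_of_notMem hξ, indicator_of_notMem hξ, norm_zero, mul_zero]
  -- The factor ⟨2πξ⟩ in the data normalizes Y(0) to the indicator of S.
  set f : L2 n := 𝓕⁻ (hF.toLp _ : L2 n) with hf
  have hFf : (𝓕 f : L2 n) = hF.toLp _ := FourierTransform.fourier_fourierInv_eq _
  obtain ⟨w, v, Y, Z, hsol, happ⟩ := exists_energyOperator_apply hbc hpos hbb f (0 : L2 n)
  have hF0 : (𝓕 (0 : L2 n) : L2 n) = 0 := fourier_L2_eq_zero_iff.2 rfl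
  have hge : κ / 64 * ‖(WithLp.toLp 2 (f, 0) : EnergySpace n)‖ ^ 2 ≤
      W t * ‖energyPair w v t‖ ^ 2 := by
    rw [(hsol.energy_integral ht).2, hsol.data_integral.2, ← integral_const_mul,
      ← integral_const_mul]
    refine integral_mono_ae (hsol.data_integral.1.const_mul _)
      ((hsol.energy_integral ht).1.const_mul _) ?_
    filter_upwards [hF.coeFn_toLp, Lp.coeFn_zero ℂ 2
      (volume : Measure (EuclideanSpace ℝ (Fin n)))] with ξ h1 h2
    have hY0 := hsol.fst_zero ξ
    have hZ0 := hsol.snd_zero ξ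
    rw [hFf, h1] at hY0
    rw [hF0, h2, Pi.zero_apply, mul_zero] at hZ0
    have hj : (japaneseSymbol n ξ : ℂ) ≠ 0 :=
      Complex.ofReal_ne_zero.2 (japaneseSymbol_pos ξ).ne'
    have hμ := laplaceSymbol_nonneg ξ
    by_cases hξ : ξ ∈ S
    · rw [indicator_of_mem hξ] at hY0
      have hY1 : Y 0 ξ = 1 := mul_left_cancel₀ hj (hY0.trans (mul_one _).symm)
      have hmain := hlow _ _ _ t ht hμ (hsol.oscillator ξ).re (by simp [hY1]) (by simp [hZ0])
        hξ.1.le hξ.2.le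
      rw [hY1, hZ0, norm_one, norm_zero]
      refine le_trans ?_ (hmain.trans ?_)
      -- On S the data density is 1 + μ ≤ 2, which turns κ/32 into κ/64.
      · nlinarith [hμ1 ξ hξ]
      · simp only [IsComplexOscillator.norm_sq_eq]
        refine mul_le_mul_of_nonneg_left ?_ hW0.le
        nlinarith [mul_nonneg hμ (sq_nonneg (Y t ξ).im), sq_nonneg (Z t ξ).im]
    · rw [indicator_of_notMem hξ] at hY0
      have hY1 : Y 0 ξ = 0 := (mul_eq_zero.1 hY0).resolve_left hj
      rw [hY1, hZ0, norm_zero]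
      have : 0 ≤ W t * (laplaceSymbol n ξ * ‖Y t ξ‖ ^ 2 + ‖Z t ξ‖ ^ 2) := by positivity
      simpa using this
  have hUne : 0 < ‖(WithLp.toLp 2 (f, 0) : EnergySpace n)‖ ^ 2 := by
    rw [energySpace_norm_sq, norm_zero, ← Lp.norm_fourier_eq, hFf]
    have hne : (hF.toLp _ : L2 n) ≠ 0 := fun h0 => by
      have h1 := hF.coeFn_toLp
      rw [h0] at h1
      have h2 : volume S = 0 := by
        refine measure_mono_null (fun ξ hξ => ?_) (ae_iff.1 (h1.symm.trans
          (Lp.coeFn_zero ℂ 2 (volume : Measure (EuclideanSpace ℝ (Fin n))))))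
        rw [mem_ofPred_eq, indicator_of_mem hξ, Pi.zero_apply]
        exact Complex.ofReal_ne_zero.2 (japaneseSymbol_pos ξ).ne'
      exact (hSo.measure_pos volume hSne).ne' h2
    have := norm_pos_iff.2 hne
    positivity
  rw [← happ t ht] at hge
  refine le_of_mul_le_mul_right ?_ hUne
  refine hge.trans ?_
  rw [mul_assoc, ← mul_pow]
  gcongr
  exact ContinuousLinearMap.le_opNorm _ _

end EnergyOperator

/-! ### Proof of the theorem: from W to the decay factor -/

theorem mainTheorem4 (n : ℕ) (hn : 1 ≤ n) (b : ℝ → ℝ)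
    (hsmooth : ContDiffOn ℝ ∞ b (Ici 0))
    (H1 : ∀ t, 0 ≤ t → 0 ≤ b t)
    (H2 : MonotoneOn b (Ici 0) ∨ AntitoneOn b (Ici 0))
    (H3 : ∀ k : ℕ, 1 ≤ k → ∃ C : ℝ, ∀ t, 0 ≤ t →
      |iteratedDerivWithin k b (Ici 0) t| ≤ C * b t * (1 / (1 + t)) ^ k)
    (hE : Tendsto (fun t => t * b t) atTop atTop)
    (hL1 : ¬ IntegrableOn (fun t => 1 / b t) (Ici 0)) :
    -- the energy operator is well defined and bounded on L²
    (∀ t, 0 ≤ t → IsEnergyOperatorAt b t (energyOperator n b t)) ∧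
    -- strong convergence to zero
    (∀ U : EnergySpace n,
      Tendsto (fun t => decayFactor b t • energyOperator n b t U) atTop (𝓝 0)) ∧
    -- no rate in the operator norm
    (¬ ∃ rate : ℝ → ℝ, Tendsto rate atTop (𝓝 0) ∧
      ∀ t, 0 ≤ t → decayFactor b t * ‖energyOperator n b t‖ ≤ rate t) ∧
    -- two-sided norm estimate
    (∃ c C : ℝ, 0 < c ∧ ∀ t, 0 ≤ t →
      c * (decayFactor b t)⁻¹ ≤ ‖energyOperator n b t‖ ∧
        ‖energyOperator n b t‖ ≤ C * (decayFactor b t)⁻¹) := by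
  set b₁ : ℝ → ℝ := fun t => b (max t 0) with hb₁
  obtain ⟨b', C₁, hb⟩ := exists_isEffectiveDamping hsmooth H1 (H3 1 le_rfl) hE
  have hbb : ∀ t, 0 ≤ t → b t = b₁ t := fun t ht => by simp only [hb₁, max_eq_left ht]
  have hL1' : ¬ IntegrableOn (fun t => 1 / b₁ t) (Ici 0) := fun h =>
    hL1 (h.congr_fun (fun t ht => by rw [hbb t ht]) measurableSet_Ici)
  have hB := hb.tendsto_invIntegral hL1'
  obtain ⟨η, W, c, D, hc, hD, hw, hW⟩ := hb.exists_isDecayWeight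
  have hWt : Tendsto W atTop atTop := by
    refine tendsto_atTop_mono' _ ?_ ((tendsto_atTop_add_const_left _ 1 hB).const_mul_atTop hc)
    filter_upwards [eventually_ge_atTop 0] with t ht
    exact (hW t ht).1
  have hdec : ∀ t, 0 ≤ t → decayFactor b t ^ 2 = 1 + invIntegral b₁ t := fun t ht => by
    rw [decayFactor, ← invIntegral_max ht]
    exact Real.sq_sqrt (by linarith [hb.invIntegral_nonneg ht])
  have hdpos : ∀ t, 0 ≤ t → 0 < decayFactor b t := fun t ht => by
    rw [decayFactor, ← invIntegral_max ht]
    exact Real.sqrt_pos.2 (by linarith [hb.invIntegral_nonneg ht])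
  obtain ⟨k, hk, hlow⟩ := exists_weighted_norm_energyOperator_ge hn hb.continuous hb.pos hbb hw
  -- A positive lower bound independent of t: it is half of the norm equivalence and also rules out
  -- any rate.
  have hlower : ∀ t, 0 ≤ t →
      Real.sqrt (k / D) ≤ decayFactor b t * ‖energyOperator n b t‖ := fun t ht => by
    rw [Real.sqrt_le_left (mul_nonneg (hdpos t ht).le (norm_nonneg _)), mul_pow, hdec t ht,
      div_le_iff₀ hD]
    refine (hlow t ht).trans ?_
    nlinarith [mul_le_mul_of_nonneg_right (hW t ht).2 (sq_nonneg ‖energyOperator n b t‖)]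
  set K := 4 * (W 0 + η 0 + 1)
  have hK : 0 ≤ K := by
    have := hw.one_le 0 le_rfl
    have := hw.nonneg 0 le_rfl
    positivity
  refine ⟨fun t ht => energyOperator_spec hb.continuous hb.pos hbb ht, fun U => ?_, ?_,
    Real.sqrt (k / D), Real.sqrt (K / c), Real.sqrt_pos.2 (by positivity), fun t ht => ⟨?_, ?_⟩⟩
  · obtain ⟨w, v, Y, Z, hsol, happ⟩ :=
      exists_energyOperator_apply hb.continuous hb.pos hbb U.fst U.snd
    have hlim := ((hsol.tendsto_weighted_norm_energyPair hb.pos hw hWt).const_mul c⁻¹).sqrt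
    rw [mul_zero, Real.sqrt_zero] at hlim
    rw [tendsto_zero_iff_norm_tendsto_zero]
    refine squeeze_zero' (Eventually.of_forall fun t => norm_nonneg _) ?_ hlim
    filter_upwards [eventually_ge_atTop 0] with t ht
    refine Real.le_sqrt_of_sq_le ?_
    rw [norm_smul, Real.norm_of_nonneg (hdpos t ht).le, mul_pow, hdec t ht,
      show energyOperator n b t U = energyPair w v t from happ t ht, ← mul_assoc]
    refine mul_le_mul_of_nonneg_right ?_ (sq_nonneg _)
    rw [le_inv_mul_iff₀ hc]
    exact (hW t ht).1
  · rintro ⟨rate, hrate, hle⟩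
    have h0 : Real.sqrt (k / D) ≤ 0 := by
      refine ge_of_tendsto hrate ?_
      filter_upwards [eventually_ge_atTop 0] with t ht
      exact (hlower t ht).trans (hle t ht)
    exact absurd h0 (not_le.2 (Real.sqrt_pos.2 (by positivity)))
  · rw [← div_eq_mul_inv, div_le_iff₀ (hdpos t ht), mul_comm]
    exact hlower t ht
  · refine ContinuousLinearMap.opNorm_le_bound _
      (mul_nonneg (Real.sqrt_nonneg _) (inv_nonneg.2 (hdpos t ht).le)) fun U => ?_
    obtain ⟨w, v, Y, Z, hsol, happ⟩ :=
      exists_energyOperator_apply hb.continuous hb.pos hbb U.fst U.snd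
    have h1 := hsol.weighted_norm_energyPair_le hw ht
    rw [← happ t ht] at h1
    change W t * ‖energyOperator n b t U‖ ^ 2 ≤ K * ‖U‖ ^ 2 at h1
    have h2 : decayFactor b t * ‖energyOperator n b t U‖ ≤ Real.sqrt (K / c) * ‖U‖ := by
      refine (le_abs_self _).trans (abs_le_of_sq_le_sq ?_
        (mul_nonneg (Real.sqrt_nonneg _) (norm_nonneg _)))
      rw [mul_pow, mul_pow, hdec t ht, Real.sq_sqrt (by positivity), div_mul_eq_mul_div,
        le_div_iff₀ hc]
      refine le_trans ?_ h1
      nlinarith [mul_le_mul_of_nonneg_right (hW t ht).1 (sq_nonneg ‖energyOperator n b t U‖)]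
    rw [mul_right_comm, ← div_eq_mul_inv, le_div_iff₀ (hdpos t ht), mul_comm]
    exact h2
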